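/- Let $\Omega\subseteq\mathbb{R}^d$ be open, let $D\subseteq\partial\Omega$ be closed, and let $V$ be the closure in $W^{1,2}(\Omega)$ (complex-valued functions) of either $\{u|_\Omega : u\in C_c^\infty(\mathbb{R}^d),\ \operatorname{dist}(\operatorname{supp}u,D)>0\}$ or $\{u\in W^{1,2}(\Omega) : \operatorname{dist}(\operatorname{supp}u,D)>0\}$. Let $\mu\colon\Omega\to\mathcal{L}(\mathbb{C}^d)$ be Lebesgue measurable, (essentially) bounded and uniformly elliptic, i.e. there is $m_\bullet>0$ with $\operatorname{Re}(\mu(x)\xi,\xi)\ge m_\bullet|\xi|^2$ for all $\xi\in\mathbb{C}^d$ and almost every $x\in\Omega$. Let $A$ be the operator in $L^2(\Omega)$ induced by the form $\mathfrak{t}(u,v)=\int_\Omega(\mu\nabla u,\nabla v)\,\mathrm{d}x$ on $V$: $u\in\operatorname{dom}(A)$ and $Au=f$ if and only if $u\in V$, $f\in L^2(\Omega)$ and $\mathfrak{t}(u,v)=(f,v)_{L^2(\Omega)}$ for all $v\in V$. Let $T$ be the strongly continuous semigroup on $L^2(\Omega)$ generated by $-A$. Let $p\in(1,\infty)$, $\frac1p+\frac1{p'}=1$.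 Let $A_p$ be the realization of $A$ in $L^p(\Omega)$, i.e. the negative generator of the strongly continuous semigroup $T_p$ on $L^p(\Omega)$ to which $T$ extrapolates, $T_p(t)f=T(t)f$ for all $t\ge0$ and $f\in L^2(\Omega)\cap L^p(\Omega)$. For $\theta\in[0,\frac\pi2]$ let $\Sigma_\theta=\{z\in\mathbb{C}:|\arg z|\le\theta\}\cup\{0\}$; let $\mathcal{J}_p(\alpha+\mathrm{i}\beta)=\frac{2\alpha}{p'}+\mathrm{i}\frac{2\beta}{p}$ for $\alpha,\beta\in\mathbb{R}^d$; and for $L\in\mathcal{L}(\mathbb{C}^d)$ let $N_p(L)=\{(L\xi,\mathcal{J}_p\xi):\xi\in\mathbb{C}^d,\ |\xi|=1\}$ be its $p$-numerical range. The numerical range of $A_p$ is $$N(A_p)=\{u^*(A_pu) : u\in\operatorname{dom}(A_p),\ \|u\|_{L^p(\Omega)}=1,\ u^*\in L^p(\Omega)^*,\ u^*(u)=\|u\|_{L^p(\Omega)},\ \|u^*\|=1\}.$$ If $\theta\in[0,\frac\pi2]$ is such that $N_p(\mu(x))\subseteq\Sigma_\theta$ for almost every $x\in\Omega$, then $N(A_p)\subseteq\Sigma_\theta$.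 -/

import Mathlib

open MeasureTheory Filter Topology
open scoped ENNReal NNReal ContDiff

noncomputable section

namespace EllipticLp

/-! ### Sectors, duality mapping and numerical ranges -/

/-- The closed sector `Σ_θ = {z : |arg z| ≤ θ} ∪ {0}`. -/
def sector (θ : ℝ) : Set ℂ := {z | |z.arg| ≤ θ} ∪ {0}

section Banach

variable {X : Type*} [NormedAddCommGroup X] [NormedSpace ℂ X]

/-- The (set-valued) duality mapping `J(u) = {u* ∈ X* : u*(u) = ‖u‖, ‖u*‖ = 1}`. -/
def dualityMap (u : X) : Set (StrongDual ℂ X) := {φ | φ u = (‖u‖ : ℂ) ∧ ‖φ‖ = 1}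

/-- The numerical range `{u*(B u) : u ∈ dom B, ‖u‖ = 1, u* ∈ J(u)}` of an operator `B` in a Banach
space. Unbounded operators are given by their graphs: `(u, f) ∈ B` means `u ∈ dom B`, `B u = f`. -/
def numericalRange (B : Set (X × X)) : Set ℂ :=
  {z | ∃ u f, (u, f) ∈ B ∧ ‖u‖ = 1 ∧ ∃ φ ∈ dualityMap u, z = φ f}

/-- Strongly continuous one-parameter semigroups of bounded operators. -/
structure IsC0Semigroup (T : ℝ≥0 → X →L[ℂ] X) : Prop where
  map_zero : T 0 = ContinuousLinearMap.id ℂ X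
  map_add : ∀ s t, T (s + t) = (T s).comp (T t)
  continuous : ∀ u, Continuous fun t => T t u

/-- The graph of the negative generator of `T`: `u` is in its domain, with value `f`, if and only if
`t⁻¹ (u - T(t) u) → f` as `t ↓ 0`. -/
def negGenerator (T : ℝ≥0 → X →L[ℂ] X) : Set (X × X) :=
  {w | Tendsto (fun t : ℝ≥0 => (((t : ℝ) : ℂ))⁻¹ • (w.1 - T t w.1)) (𝓝[>] 0) (𝓝 w.2)}

end Banach

/-! ### The `p`-numerical range of a matrix -/

/-- Complex `d`-space with its Euclidean norm. -/
abbrev Cd (d : ℕ) : Type := EuclideanSpace ℂ (Fin d)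

/-- Real `d`-space with its Euclidean norm. -/
abbrev Rd (d : ℕ) : Type := EuclideanSpace ℝ (Fin d)

/-- The real-linear map `𝒥_p (α + i β) = 2 α / p' + i 2 β / p` on `ℂ^d`, where `1/p + 1/p' = 1`. -/
def Jp {d : ℕ} (p : ℝ) (ξ : Cd d) : Cd d :=
  WithLp.toLp 2 fun i => ⟨2 * (ξ i).re / p.conjExponent, 2 * (ξ i).im / p⟩

/-- The `p`-numerical range `N_p(L) = {(L ξ, 𝒥_p ξ) : |ξ| = 1}`. The inner product `(a, b)`, linear
in `a`, is `inner ℂ b a` in Mathlib's convention. -/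
def pNumericalRange {d : ℕ} (p : ℝ) (L : Cd d →L[ℂ] Cd d) : Set ℂ :=
  {z | ∃ ξ : Cd d, ‖ξ‖ = 1 ∧ z = inner ℂ (Jp p ξ) (L ξ)}

/-! ### The Sobolev space `W^{1,2}(Ω)` and the form domains -/

/-- The complex Lebesgue space `L^p(Ω)`. -/
abbrev LpΩ {d : ℕ} (p : ℝ≥0∞) (Ω : Set (Rd d)) : Type :=
  Lp ℂ p (volume.restrict Ω)

/-- The space `L^2(Ω; ℂ^d)` of square integrable vector fields. -/
abbrev L2Field {d : ℕ} (Ω : Set (Rd d)) : Type :=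
  Lp (Cd d) 2 (volume.restrict Ω)

/-- `g` is the weak gradient of `u` on `Ω`. -/
def IsWeakGradient {d : ℕ} (Ω : Set (Rd d)) (u : Rd d → ℂ) (g : Rd d → Cd d) : Prop :=
  ∀ φ : Rd d → ℝ, ContDiff ℝ ∞ φ → HasCompactSupport φ → tsupport φ ⊆ Ω → ∀ i : Fin d,
    ∫ x in Ω, (fderiv ℝ φ x (EuclideanSpace.single i 1)) • u x = - ∫ x in Ω, φ x • g x i

/-- `W^{1,2}(Ω)`; an element is recorded together with its (unique) weak gradient, as the pair
`(u, ∇u) ∈ L^2(Ω) × L^2(Ω; ℂ^d)`. The topology of `W^{1,2}(Ω)` is the one induced by that product. -/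
def W12 {d : ℕ} (Ω : Set (Rd d)) : Set (LpΩ 2 Ω × L2Field Ω) :=
  {w | IsWeakGradient Ω w.1 w.2}

/-- The essential support of `u` on `Ω`: the points near which `u` does not vanish a.e. -/
def essSupport {d : ℕ} (Ω : Set (Rd d)) (u : Rd d → ℂ) : Set (Rd d) :=
  {x | ∀ U ∈ 𝓝 x, ¬ ∀ᵐ y ∂(volume.restrict Ω), y ∈ U → u y = 0}

/-- The restrictions to `Ω` of the functions in `C_c^∞(ℝ^d)` whose support has positive distance
to `D` (with `dist(∅, D) = dist(S, ∅) = ∞`), as elements of `W^{1,2}(Ω)`. -/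
def smoothD {d : ℕ} (Ω D : Set (Rd d)) : Set (LpΩ 2 Ω × L2Field Ω) :=
  {w | w ∈ W12 Ω ∧ ∃ φ : Rd d → ℂ, ContDiff ℝ ∞ φ ∧ HasCompactSupport φ ∧
    Metric.AreSeparated (tsupport φ) D ∧ w.1 =ᵐ[volume.restrict Ω] φ}

/-- The functions in `W^{1,2}(Ω)` whose support has positive distance to `D`. -/
def sobolevD {d : ℕ} (Ω D : Set (Rd d)) : Set (LpΩ 2 Ω × L2Field Ω) :=
  {w | w ∈ W12 Ω ∧ Metric.AreSeparated (essSupport Ω w.1) D}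

/-- `V` is one of the two admissible form domains with Dirichlet condition on `D`: the closure in
`W^{1,2}(Ω)` of `smoothD Ω D` or of `sobolevD Ω D`. -/
def IsFormDomain {d : ℕ} (Ω D : Set (Rd d)) (V : Set (LpΩ 2 Ω × L2Field Ω)) : Prop :=
  V = W12 Ω ∩ closure (smoothD Ω D) ∨ V = W12 Ω ∩ closure (sobolevD Ω D)

/-! ### The form, the operator on `L^2(Ω)`, and extrapolation to `L^p(Ω)` -/

/-- The sesquilinear form `𝔱(u, v) = ∫_Ω (μ ∇u, ∇v) dx`. -/
def form {d : ℕ} (Ω : Set (Rd d)) (μ : Rd d → Cd d →L[ℂ] Cd d)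
    (w z : LpΩ 2 Ω × L2Field Ω) : ℂ :=
  ∫ x in Ω, inner ℂ (z.2 x) (μ x (w.2 x))

/-- The graph of the operator `A` induced on `L^2(Ω)` by the form restricted to `V`: `A u = f` iff
`u ∈ V` and `𝔱(u, v) = (f, v)_{L^2(Ω)}` for all `v ∈ V`. -/
def formOperator {d : ℕ} (Ω : Set (Rd d)) (μ : Rd d → Cd d →L[ℂ] Cd d)
    (V : Set (LpΩ 2 Ω × L2Field Ω)) : Set (LpΩ 2 Ω × LpΩ 2 Ω) :=
  {a | ∃ w ∈ V, w.1 = a.1 ∧ ∀ z ∈ V, form Ω μ w z = inner ℂ z.1 a.2}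

/-- The families `T` on `L^2(Ω)` and `S` on `L^p(Ω)` agree on `L^2(Ω) ∩ L^p(Ω)`. -/
def Consistent {d : ℕ} {Ω : Set (Rd d)} {p : ℝ≥0∞} [Fact (1 ≤ p)]
    (T : ℝ≥0 → LpΩ 2 Ω →L[ℂ] LpΩ 2 Ω) (S : ℝ≥0 → LpΩ p Ω →L[ℂ] LpΩ p Ω) : Prop :=
  ∀ (t : ℝ≥0) (f : LpΩ 2 Ω) (g : LpΩ p Ω), f =ᵐ[volume.restrict Ω] g →
    T t f =ᵐ[volume.restrict Ω] S t g

/-- `B` is (the graph of) the realization `A_p` in `L^p(Ω)` of an operator `A` in `L^2(Ω)`: `-A`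
generates a strongly continuous semigroup `T` on `L^2(Ω)`, which extrapolates consistently to a
strongly continuous semigroup `T_p` on `L^p(Ω)`, and `-B` is the generator of `T_p`. As `A`
determines `T`, and `T` determines `T_p` by density, there is at most one such `B`. -/
def IsLpRealization {d : ℕ} {Ω : Set (Rd d)} {p : ℝ≥0∞} [Fact (1 ≤ p)]
    (A : Set (LpΩ 2 Ω × LpΩ 2 Ω)) (B : Set (LpΩ p Ω × LpΩ p Ω)) : Prop :=
  ∃ (T : ℝ≥0 → LpΩ 2 Ω →L[ℂ] LpΩ 2 Ω) (Tp : ℝ≥0 → LpΩ p Ω →L[ℂ] LpΩ p Ω),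
    IsC0Semigroup T ∧ negGenerator T = A ∧ IsC0Semigroup Tp ∧ Consistent T Tp ∧ negGenerator Tp = B

end EllipticLp

end

/-!
The sector `Σ_θ` is the intersection of the half-planes `{z | 0 ≤ Re (c z)}` over `c ∈ Σ_{π/2 - θ}`,
and the normalized duality functional of a unit vector `u ∈ L^p` is `f ↦ ∫ f |u|^{p-2} ū`. So the
claim is that `0 ≤ Re (c ∫ (A_p u) |u|^{p-2} ū)` for all `u ∈ dom(A_p)` and all such `c`.

For `v` in the domain of `A`, one tests the equation `A v = f` with `Φ_ε(v)`, where the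
regularization `Φ_ε(z) = ((ε + |z|²) / (1 + ε |z|²))^{(p-2)/2} z` of `|z|^{p-2} z` has a bounded
derivative and therefore operates on the form domain. The point is that, for a positive number `w` and some `κ`
with `0 ≤ κ |z|² ≤ 1`,
`DΦ_ε(z) ξ = w ((1 - κ |z|²)/2 (𝒥_p ξ - i 𝒥_p(i ξ)) + κ p/2 z 𝒥_p(z̄ ξ))`.
Hence `(μ ξ, DΦ_ε(z) ξ)` is a combination with nonnegative coefficients of values
`(μ η, 𝒥_p η)`, all of which lie in `Σ_θ`. Letting `ε → 0` settles the case that `v` and `A v` are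
in `L^2 ∩ L^p`.

The means `h⁻¹ ∫₀ʰ T(s) g ds` with `g ∈ L^2 ∩ L^p` provide enough such `v`: the set they form, with
the values of `A_p` on it, is dense in the graph of `A_p`, and the claimed inequality is closed.
-/

namespace EllipticLp

/-! ### Sectors -/

theorem mem_sector_iff_abs_arg_le {θ : ℝ} (hθ : 0 ≤ θ) {z : ℂ} : z ∈ sector θ ↔ |z.arg| ≤ θ := by
  simp only [sector, Set.mem_union, Set.mem_ofPred_eq, Set.mem_singleton_iff, or_iff_left_iff_imp]
  rintro rfl
  simpa using hθ

theorem re_mul_eq_norm_mul_norm_mul_cos (c z : ℂ) :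
    (c * z).re = ‖c‖ * ‖z‖ * Real.cos (c.arg + z.arg) := by
  rw [Real.cos_add, Complex.mul_re, ← Complex.norm_mul_cos_arg c, ← Complex.norm_mul_cos_arg z,
    ← Complex.norm_mul_sin_arg c, ← Complex.norm_mul_sin_arg z]
  ring

theorem mem_sector_iff_forall_mem_sector {θ : ℝ} (hθ : 0 ≤ θ) (hθ' : θ ≤ Real.pi / 2) {z : ℂ} :
    z ∈ sector θ ↔ ∀ c ∈ sector (Real.pi / 2 - θ), 0 ≤ (c * z).re := by
  have hθ'' : 0 ≤ Real.pi / 2 - θ := sub_nonneg.2 hθ'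
  simp only [mem_sector_iff_abs_arg_le hθ, mem_sector_iff_abs_arg_le hθ'',
    re_mul_eq_norm_mul_norm_mul_cos]
  refine ⟨fun hz c hc => ?_, fun h => ?_⟩
  · have : |c.arg + z.arg| ≤ Real.pi / 2 := (abs_add_le _ _).trans (by linarith)
    exact mul_nonneg (by positivity) (Real.cos_nonneg_of_mem_Icc (abs_le.1 this))
  have hre : 0 ≤ ‖z‖ * Real.cos z.arg := by simpa [hθ''] using h 1
  by_contra! hz
  have hz0 : 0 < ‖z‖ := by
    rw [norm_pos_iff]
    rintro rfl
    simp only [Complex.arg_zero, abs_zero] at hz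
    exact hz.not_ge hθ
  have harg : |z.arg| ≤ Real.pi / 2 := Complex.abs_arg_le_pi_div_two_iff.2 <| by
    rwa [← Complex.norm_mul_cos_arg]
  -- Turning `z` further away from the positive axis by `π / 2 - θ` leaves the right half-plane.
  have hturn : ∀ α : ℝ, |α| = Real.pi / 2 - θ → |α + z.arg| = |α| + |z.arg| → False := by
    intro α hα hadd
    have hαπ : α ∈ Set.Ioc (-Real.pi) Real.pi := by
      have := Real.pi_pos
      constructor <;> linarith [abs_le.1 hα.le]
    have hexp : (Complex.exp (α * Complex.I)).arg = α := by
      rw [Complex.exp_mul_I, Complex.arg_cos_add_sin_mul_I hαπ]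
    have hcα := h (Complex.exp (α * Complex.I))
    rw [hexp, Complex.norm_exp_ofReal_mul_I, one_mul, ← Real.cos_abs, hadd, hα] at hcα
    have hcos := Real.cos_neg_of_pi_div_two_lt_of_lt (x := Real.pi / 2 - θ + |z.arg|)
      (by linarith) (by linarith)
    exact (mul_neg_of_pos_of_neg hz0 hcos).not_ge (hcα le_rfl)
  rcases le_total 0 z.arg with hpos | hneg
  · exact hturn (Real.pi / 2 - θ) (abs_of_nonneg hθ'')
      (abs_add_eq_add_abs_iff _ _ |>.2 (.inl ⟨hθ'', hpos⟩))
  · exact hturn (-(Real.pi / 2 - θ)) (by rw [abs_neg, abs_of_nonneg hθ''])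
      (abs_add_eq_add_abs_iff _ _ |>.2 (.inr ⟨neg_nonpos.2 hθ'', hneg⟩))

/-! ### Superposition operators between Lebesgue spaces -/

section Convergence

variable {α E F : Type*} [MeasurableSpace α] {μ : Measure α} [NormedAddCommGroup E]
  [NormedAddCommGroup F]

theorem tendsto_integral_of_integral_le {G : ℕ → α → ℝ} {g : α → ℝ} (hG : ∀ n, Integrable (G n) μ)
    (hg : Integrable g μ) (hG_nonneg : ∀ n, 0 ≤ᵐ[μ] G n)
    (hlim : ∀ᵐ x ∂μ, Tendsto (G · x) atTop (𝓝 (g x))) (hle : ∀ n, ∫ x, G n x ∂μ ≤ ∫ x, g x ∂μ) :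
    Tendsto (fun n => ∫ x, G n x ∂μ) atTop (𝓝 (∫ x, g x ∂μ)) := by
  have hmin : Tendsto (fun n => ∫ x, min (G n x) (g x) ∂μ) atTop (𝓝 (∫ x, g x ∂μ)) := by
    refine tendsto_integral_of_dominated_convergence (fun x => |g x|)
      (fun n => ((hG n).inf hg).aestronglyMeasurable) hg.abs (fun n => ?_) ?_
    · filter_upwards [hG_nonneg n] with x hx
      rw [Real.norm_eq_abs, abs_le]
      exact ⟨le_min ((neg_nonpos.2 (abs_nonneg _)).trans hx) (neg_abs_le _),
        (min_le_right _ _).trans (le_abs_self _)⟩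
    · filter_upwards [hlim] with x hx
      simpa using hx.min (tendsto_const_nhds (x := g x))
  exact tendsto_of_tendsto_of_tendsto_of_le_of_le hmin tendsto_const_nhds
    (fun n => integral_mono ((hG n).inf hg) (hG n) fun x => min_le_left _ _) hle

theorem tendsto_integral_zero_of_dominated {H G : ℕ → α → ℝ} {g : α → ℝ}
    (hH : ∀ n, AEStronglyMeasurable (H n) μ) (hG : ∀ n, Integrable (G n) μ) (hg : Integrable g μ)
    (hH_nonneg : ∀ n, 0 ≤ᵐ[μ] H n) (hHG : ∀ n, H n ≤ᵐ[μ] G n)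
    (hH_lim : ∀ᵐ x ∂μ, Tendsto (H · x) atTop (𝓝 0))
    (hG_lim : ∀ᵐ x ∂μ, Tendsto (G · x) atTop (𝓝 (g x)))
    (hG_int : Tendsto (fun n => ∫ x, G n x ∂μ) atTop (𝓝 (∫ x, g x ∂μ))) :
    Tendsto (fun n => ∫ x, H n x ∂μ) atTop (𝓝 0) := by
  have hHi : ∀ n, Integrable (H n) μ := fun n => (hG n).mono' (hH n) <| by
    filter_upwards [hH_nonneg n, hHG n] with x h0 hle
    rwa [Real.norm_of_nonneg h0]
  have hKi : ∀ n, Integrable (fun x => min (G n x - H n x) (g x)) μ := fun n =>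
    ((hG n).sub (hHi n)).inf hg
  have hK_int : Tendsto (fun n => ∫ x, min (G n x - H n x) (g x) ∂μ) atTop (𝓝 (∫ x, g x ∂μ)) := by
    refine tendsto_integral_of_dominated_convergence (fun x => |g x|)
      (fun n => (hKi n).aestronglyMeasurable) hg.abs (fun n => ?_) ?_
    · filter_upwards [hHG n] with x hle
      rw [Real.norm_eq_abs, abs_le]
      exact ⟨le_min ((neg_nonpos.2 (abs_nonneg _)).trans (sub_nonneg.2 hle)) (neg_abs_le _),
        (min_le_right _ _).trans (le_abs_self _)⟩
    · filter_upwards [hH_lim, hG_lim] with x hHx hGx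
      simpa using (hGx.sub hHx).min (tendsto_const_nhds (x := g x))
  refine squeeze_zero' (.of_forall fun n => integral_nonneg_of_ae (hH_nonneg n))
    (.of_forall fun n => ?_) (by simpa using hG_int.sub hK_int)
  rw [← integral_sub (hG n) (hKi n)]
  refine integral_mono (hHi n) ((hG n).sub (hKi n)) fun x => ?_
  linarith [min_le_left (G n x - H n x) (g x)]

theorem tendsto_integral_norm_sub_of_dominated {H : ℕ → α → E} {h : α → E} {G : ℕ → α → ℝ}
    {g : α → ℝ} (hH : ∀ n, AEStronglyMeasurable (H n) μ) (hG : ∀ n, Integrable (G n) μ)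
    (hg : Integrable g μ) (hHG : ∀ n, ∀ᵐ x ∂μ, ‖H n x‖ ≤ G n x)
    (hH_lim : ∀ᵐ x ∂μ, Tendsto (H · x) atTop (𝓝 (h x)))
    (hG_lim : ∀ᵐ x ∂μ, Tendsto (G · x) atTop (𝓝 (g x)))
    (hG_int : Tendsto (fun n => ∫ x, G n x ∂μ) atTop (𝓝 (∫ x, g x ∂μ))) :
    Tendsto (fun n => ∫ x, ‖H n x - h x‖ ∂μ) atTop (𝓝 0) := by
  have hh : AEStronglyMeasurable h μ := aestronglyMeasurable_of_tendsto_ae atTop hH hH_lim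
  have hhg : ∀ᵐ x ∂μ, ‖h x‖ ≤ g x := by
    filter_upwards [ae_all_iff.2 hHG, hH_lim, hG_lim] with x hle hHx hGx
    exact le_of_tendsto_of_tendsto' hHx.norm hGx hle
  refine tendsto_integral_zero_of_dominated (G := fun n x => G n x + g x)
    (g := fun x => g x + g x) (fun n => ((hH n).sub hh).norm) (fun n => (hG n).add hg) (hg.add hg)
    (fun n => .of_forall fun x => norm_nonneg _) (fun n => ?_) ?_ ?_ ?_
  · filter_upwards [hHG n, hhg] with x hHx hhx
    exact (norm_sub_le _ _).trans (add_le_add hHx hhx)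
  · filter_upwards [hH_lim] with x hx
    exact tendsto_iff_norm_sub_tendsto_zero.1 hx
  · filter_upwards [hG_lim] with x hx
    exact hx.add_const _
  · simpa only [integral_add (hG _) hg, integral_add hg hg] using hG_int.add_const (∫ x, g x ∂μ)

theorem tendsto_integral_smul_of_tendsto_integral_norm_sub [NormedSpace ℝ E] {H : ℕ → α → E}
    {h : α → E} {η : α → ℝ} {M : ℝ} (hη : AEStronglyMeasurable η μ) (hM : ∀ x, ‖η x‖ ≤ M)
    (hH : ∀ n, Integrable (H n) μ) (hh : Integrable h μ)
    (hlim : Tendsto (fun n => ∫ x, ‖H n x - h x‖ ∂μ) atTop (𝓝 0)) :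
    Tendsto (fun n => ∫ x, η x • H n x ∂μ) atTop (𝓝 (∫ x, η x • h x ∂μ)) := by
  have hM' : ∀ᵐ x ∂μ, ‖η x‖ ≤ M := .of_forall hM
  rw [tendsto_iff_norm_sub_tendsto_zero]
  refine squeeze_zero (fun n => norm_nonneg _) (fun n => ?_) (by simpa using hlim.const_mul M)
  have hsub : ∫ x, η x • H n x ∂μ - ∫ x, η x • h x ∂μ = ∫ x, η x • (H n x - h x) ∂μ := by
    simp only [smul_sub]
    exact (integral_sub ((hH n).bdd_smul M hη hM') (hh.bdd_smul M hη hM')).symm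
  rw [hsub, ← integral_const_mul]
  refine norm_integral_le_of_norm_le (((hH n).sub hh).norm.const_mul M) (.of_forall fun x => ?_)
  rw [norm_smul]
  exact mul_le_mul_of_nonneg_right (hM x) (norm_nonneg _)

theorem integral_norm_rpow_eq_toReal_eLpNorm_rpow {f : α → E} {p : ℝ≥0∞} (hp₀ : p ≠ 0)
    (hp : p ≠ ⊤) (hf : AEStronglyMeasurable f μ) :
    ∫ x, ‖f x‖ ^ p.toReal ∂μ = (eLpNorm f p μ).toReal ^ p.toReal := by
  rw [toReal_eLpNorm hf, lpNorm_eq_integral_norm_rpow_toReal hp₀ hp hf,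
    Real.rpow_inv_rpow (integral_nonneg fun x => by positivity) (ENNReal.toReal_pos hp₀ hp).ne']

theorem tendsto_eLpNorm_of_tendsto_eLpNorm_sub {f : ℕ → α → E} {g : α → E} {p : ℝ≥0∞}
    (hp : 1 ≤ p) (hf : ∀ n, MemLp (f n) p μ) (hg : MemLp g p μ)
    (hfg : Tendsto (fun n => eLpNorm (f n - g) p μ) atTop (𝓝 0)) :
    Tendsto (fun n => eLpNorm (f n) p μ) atTop (𝓝 (eLpNorm g p μ)) := by
  have : Fact (1 ≤ p) := ⟨hp⟩
  have := ((Lp.tendsto_Lp_iff_tendsto_eLpNorm'' f hf g hg).2 hfg).enorm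
  simpa only [Lp.enorm_toLp] using this

section Nemytskii

variable {p q : ℝ≥0∞} {Ψ : E → F} {C : ℝ}

theorem norm_rpow_le_of_norm_le_rpow (hq₀ : q ≠ 0) (hq : q ≠ ⊤)
    (hC : ∀ x, ‖Ψ x‖ ≤ C * ‖x‖ ^ (p.toReal / q.toReal)) (x : E) :
    ‖Ψ x‖ ^ q.toReal ≤ |C| ^ q.toReal * ‖x‖ ^ p.toReal := by
  have hq' := ENNReal.toReal_pos hq₀ hq
  calc ‖Ψ x‖ ^ q.toReal ≤ (|C| * ‖x‖ ^ (p.toReal / q.toReal)) ^ q.toReal := by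
        gcongr
        exact (hC x).trans (by gcongr; exact le_abs_self C)
    _ = |C| ^ q.toReal * ‖x‖ ^ p.toReal := by
        rw [Real.mul_rpow (abs_nonneg C) (by positivity), ← Real.rpow_mul (norm_nonneg x),
          div_mul_cancel₀ _ hq'.ne']

theorem memLp_comp_of_norm_le_rpow (hΨ : Continuous Ψ) (hp₀ : p ≠ 0) (hp : p ≠ ⊤) (hq₀ : q ≠ 0)
    (hq : q ≠ ⊤) (hC : ∀ x, ‖Ψ x‖ ≤ C * ‖x‖ ^ (p.toReal / q.toReal)) {f : α → E}
    (hf : MemLp f p μ) : MemLp (fun x => Ψ (f x)) q μ := by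
  have hm := hΨ.comp_aestronglyMeasurable hf.1
  refine (integrable_norm_rpow_iff hm hq₀ hq).1 <|
    ((hf.integrable_norm_rpow hp₀ hp).const_mul (|C| ^ q.toReal)).mono'
      (hm.norm.aemeasurable.pow_const _).aestronglyMeasurable (.of_forall fun x => ?_)
  rw [Real.norm_of_nonneg (by positivity)]
  exact norm_rpow_le_of_norm_le_rpow hq₀ hq hC (f x)

theorem norm_sub_rpow_le_of_norm_le_rpow (hq₀ : q ≠ 0) (hq : q ≠ ⊤)
    (hC : ∀ x, ‖Ψ x‖ ≤ C * ‖x‖ ^ (p.toReal / q.toReal)) (x y : E) :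
    ‖Ψ x - Ψ y‖ ^ q.toReal ≤
      2 ^ q.toReal * |C| ^ q.toReal * (‖x‖ ^ p.toReal + ‖y‖ ^ p.toReal) := by
  calc ‖Ψ x - Ψ y‖ ^ q.toReal ≤ (2 * max ‖Ψ x‖ ‖Ψ y‖) ^ q.toReal := by
        gcongr
        exact (norm_sub_le _ _).trans <| (add_le_add (le_max_left _ _) (le_max_right _ _)).trans_eq
          (two_mul _).symm
    _ = 2 ^ q.toReal * max (‖Ψ x‖ ^ q.toReal) (‖Ψ y‖ ^ q.toReal) := by
        rw [Real.mul_rpow zero_le_two (by positivity),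
          (Real.monotoneOn_rpow_Ici_of_exponent_nonneg ENNReal.toReal_nonneg).map_max
            (norm_nonneg _) (norm_nonneg _)]
    _ ≤ 2 ^ q.toReal * (‖Ψ x‖ ^ q.toReal + ‖Ψ y‖ ^ q.toReal) := by
        gcongr
        exact max_le_add_of_nonneg (by positivity) (by positivity)
    _ ≤ 2 ^ q.toReal * |C| ^ q.toReal * (‖x‖ ^ p.toReal + ‖y‖ ^ p.toReal) := by
        rw [mul_assoc, mul_add (|C| ^ q.toReal)]
        gcongr <;> exact norm_rpow_le_of_norm_le_rpow hq₀ hq hC _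

theorem tendsto_eLpNorm_comp_sub_of_ae_tendsto (hΨ : Continuous Ψ) (hp₀ : p ≠ 0) (hp : p ≠ ⊤)
    (hq₀ : q ≠ 0) (hq : q ≠ ⊤) (hC : ∀ x, ‖Ψ x‖ ≤ C * ‖x‖ ^ (p.toReal / q.toReal)) {f : ℕ → α → E}
    {g : α → E} (hf : ∀ n, MemLp (f n) p μ) (hg : MemLp g p μ)
    (hlim : ∀ᵐ x ∂μ, Tendsto (f · x) atTop (𝓝 (g x)))
    (hint : Tendsto (fun n => ∫ x, ‖f n x‖ ^ p.toReal ∂μ) atTop (𝓝 (∫ x, ‖g x‖ ^ p.toReal ∂μ))) :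
    Tendsto (fun n => eLpNorm (fun x => Ψ (f n x) - Ψ (g x)) q μ) atTop (𝓝 0) := by
  have hp' := ENNReal.toReal_pos hp₀ hp
  have hq' := ENNReal.toReal_pos hq₀ hq
  have hΨsub : ∀ n, MemLp (fun x => Ψ (f n x) - Ψ (g x)) q μ := fun n =>
    (memLp_comp_of_norm_le_rpow hΨ hp₀ hp hq₀ hq hC (hf n)).sub
      (memLp_comp_of_norm_le_rpow hΨ hp₀ hp hq₀ hq hC hg)
  have hsum : ∀ {h : α → E}, MemLp h p μ →
      Integrable (fun x => ‖h x‖ ^ p.toReal + ‖g x‖ ^ p.toReal) μ := fun hh =>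
    (hh.integrable_norm_rpow hp₀ hp).add (hg.integrable_norm_rpow hp₀ hp)
  have hzero : Tendsto (fun n => ∫ x, ‖Ψ (f n x) - Ψ (g x)‖ ^ q.toReal ∂μ) atTop (𝓝 0) := by
    refine tendsto_integral_zero_of_dominated
      (fun n => ((hΨsub n).integrable_norm_rpow hq₀ hq).1)
      (fun n => (hsum (hf n)).const_mul (2 ^ q.toReal * |C| ^ q.toReal))
      ((hsum hg).const_mul (2 ^ q.toReal * |C| ^ q.toReal))
      (fun n => .of_forall fun x => by positivity)
      (fun n => .of_forall fun x => norm_sub_rpow_le_of_norm_le_rpow hq₀ hq hC _ _) ?_ ?_ ?_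
    · filter_upwards [hlim] with x hx
      have h0 := tendsto_iff_norm_sub_tendsto_zero.1 ((hΨ.tendsto (g x)).comp hx)
      simpa [Real.zero_rpow hq'.ne'] using h0.rpow_const (.inr hq'.le)
    · filter_upwards [hlim] with x hx
      exact ((hx.norm.rpow_const (.inr hp'.le)).add_const _).const_mul _
    · simp only [integral_const_mul, integral_add ((hf _).integrable_norm_rpow hp₀ hp)
        (hg.integrable_norm_rpow hp₀ hp), integral_add (hg.integrable_norm_rpow hp₀ hp)
        (hg.integrable_norm_rpow hp₀ hp)]
      exact (hint.add_const _).const_mul _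
  simp only [(hΨsub _).eLpNorm_eq_integral_rpow_norm hq₀ hq]
  simpa [Real.zero_rpow (inv_pos.2 hq').ne'] using
    ENNReal.tendsto_ofReal (hzero.rpow_const (p := q.toReal⁻¹) (.inr (inv_pos.2 hq').le))

theorem tendsto_eLpNorm_comp_sub_of_tendsto_eLpNorm_sub (hΨ : Continuous Ψ) (hp : 1 ≤ p)
    (hp' : p ≠ ⊤) (hq₀ : q ≠ 0) (hq : q ≠ ⊤) (hC : ∀ x, ‖Ψ x‖ ≤ C * ‖x‖ ^ (p.toReal / q.toReal))
    {f : ℕ → α → E} {g : α → E} (hf : ∀ n, MemLp (f n) p μ) (hg : MemLp g p μ)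
    (hfg : Tendsto (fun n => eLpNorm (f n - g) p μ) atTop (𝓝 0)) :
    Tendsto (fun n => eLpNorm (fun x => Ψ (f n x) - Ψ (g x)) q μ) atTop (𝓝 0) := by
  have hp₀ : p ≠ 0 := (zero_lt_one.trans_le hp).ne'
  have hint : Tendsto (fun n => ∫ x, ‖f n x‖ ^ p.toReal ∂μ) atTop
      (𝓝 (∫ x, ‖g x‖ ^ p.toReal ∂μ)) := by
    simp only [integral_norm_rpow_eq_toReal_eLpNorm_rpow hp₀ hp', (hf _).1, hg.1]
    exact ((ENNReal.tendsto_toReal hg.2.ne).comp (tendsto_eLpNorm_of_tendsto_eLpNorm_sub hp hf hg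
      hfg)).rpow_const (.inr ENNReal.toReal_nonneg)
  refine tendsto_of_subseq_tendsto fun ns hns => ?_
  obtain ⟨ms, hms, hae⟩ := (tendstoInMeasure_of_tendsto_eLpNorm hp₀ (fun n => (hf (ns n)).1) hg.1
    (hfg.comp hns)).exists_seq_tendsto_ae
  exact ⟨ms, tendsto_eLpNorm_comp_sub_of_ae_tendsto hΨ hp₀ hp' hq₀ hq hC (fun n => hf (ns (ms n)))
    hg hae (hint.comp (hns.comp hms.tendsto_atTop))⟩

variable [hp₁ : Fact (1 ≤ p)] [hq₁ : Fact (1 ≤ q)]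

theorem memLp_coeFn_comp (hΨ : Continuous Ψ) (hp : p ≠ ⊤) (hq : q ≠ ⊤)
    (hC : ∀ x, ‖Ψ x‖ ≤ C * ‖x‖ ^ (p.toReal / q.toReal)) (f : Lp E p μ) :
    MemLp (fun x => Ψ (f x)) q μ :=
  memLp_comp_of_norm_le_rpow hΨ (zero_lt_one.trans_le hp₁.out).ne' hp
    (zero_lt_one.trans_le hq₁.out).ne' hq hC (Lp.memLp f)

variable (hΨ : Continuous Ψ) (hp : p ≠ ⊤) (hq : q ≠ ⊤)
  (hC : ∀ x, ‖Ψ x‖ ≤ C * ‖x‖ ^ (p.toReal / q.toReal))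

/-- The Nemytskii (superposition) operator `f ↦ Ψ ∘ f` from `L^p` to `L^q`, for a continuous `Ψ`
with `‖Ψ x‖ ≤ C ‖x‖^(p/q)`. -/
noncomputable def nemytskii (f : Lp E p μ) : Lp F q μ :=
  (memLp_coeFn_comp hΨ hp hq hC f).toLp

theorem coeFn_nemytskii (f : Lp E p μ) : nemytskii hΨ hp hq hC f =ᵐ[μ] fun x => Ψ (f x) :=
  MemLp.coeFn_toLp _

theorem continuous_nemytskii : Continuous (nemytskii (μ := μ) hΨ hp hq hC) := by
  refine continuous_iff_seqContinuous.2 fun f g hfg => ?_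
  rw [Lp.tendsto_Lp_iff_tendsto_eLpNorm'] at hfg
  exact (Lp.tendsto_Lp_iff_tendsto_eLpNorm'' _
    (fun n => memLp_coeFn_comp hΨ hp hq hC (f n)) _ _).2 <|
      tendsto_eLpNorm_comp_sub_of_tendsto_eLpNorm_sub hΨ hp₁.out hp
        (zero_lt_one.trans_le hq₁.out).ne' hq hC (fun n => Lp.memLp (f n)) (Lp.memLp g) hfg

end Nemytskii

end Convergence

/-! ### Mollification and the chain rule for weak gradients -/

theorem exists_contDiffBump_seq {E : Type*} [NormedAddCommGroup E] {δ : ℝ} (hδ : 0 < δ) :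
    ∃ b : ℕ → ContDiffBump (0 : E), Tendsto (fun n => (b n).rOut) atTop (𝓝 0) ∧
      (∀ n, (b n).rOut ≤ 2 * (b n).rIn) ∧ ∀ n, (b n).rOut ≤ δ := by
  obtain ⟨r, -, hr, hr_lim⟩ := exists_seq_strictAnti_tendsto' (half_pos hδ)
  refine ⟨fun n => ⟨r n, 2 * r n, (hr n).1, by linarith [(hr n).1]⟩, ?_, fun _ => le_rfl,
    fun n => ?_⟩
  · simpa using hr_lim.const_mul 2
  · change 2 * r n ≤ δ
    linarith [(hr n).2]

section Mollify

open scoped Convolution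

variable {E F : Type*} [NormedAddCommGroup E] [NormedSpace ℝ E] [FiniteDimensional ℝ E]
  [HasContDiffBump E] [MeasurableSpace E] [BorelSpace E] {μ : Measure E} [μ.IsAddHaarMeasure]
  [NormedAddCommGroup F] [NormedSpace ℝ F]

/-- The mollification of `f` by a normalized bump function. -/
noncomputable def mollify (μ : Measure E) (b : ContDiffBump (0 : E)) (f : E → F) : E → F :=
  b.normed μ ⋆[ContinuousLinearMap.lsmul ℝ ℝ, μ] f

variable {f : E → F}

theorem mollify_apply (b : ContDiffBump (0 : E)) (f : E → F) (x : E) :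
    mollify μ b f x = ∫ y, b.normed μ (x - y) • f y ∂μ := by
  simp [mollify, convolution_eq_swap]

theorem integrable_mollify (b : ContDiffBump (0 : E)) (hf : Integrable f μ) :
    Integrable (mollify μ b f) μ :=
  b.integrable_normed.integrable_convolution _ hf

theorem integral_norm_mollify_le (b : ContDiffBump (0 : E)) (hf : Integrable f μ) :
    ∫ x, ‖mollify μ b f x‖ ∂μ ≤ ∫ x, ‖f x‖ ∂μ := by
  have hmass : ∫ x, mollify μ b (fun y => ‖f y‖) x ∂μ = ∫ x, ‖f x‖ ∂μ := by
    unfold mollify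
    rw [integral_convolution _ b.integrable_normed hf.norm, b.integral_normed,
      ContinuousLinearMap.lsmul_apply, one_smul]
  rw [← hmass]
  refine integral_mono (integrable_mollify b hf).norm (integrable_mollify b hf.norm) fun x => ?_
  simp only [mollify_apply]
  refine (norm_integral_le_integral_norm _).trans_eq (integral_congr_ae (.of_forall fun y => ?_))
  simp only [norm_smul, Real.norm_of_nonneg (b.nonneg_normed _), smul_eq_mul]

theorem contDiff_mollify (b : ContDiffBump (0 : E)) (hf : Integrable f μ) :
    ContDiff ℝ ∞ (mollify μ b f) :=
  b.hasCompactSupport_normed.contDiff_convolution_left _ b.contDiff_normed hf.locallyIntegrable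

theorem fderiv_mollify_apply (b : ContDiffBump (0 : E)) (hf : Integrable f μ) (x v : E) :
    fderiv ℝ (mollify μ b f) x v = ∫ y, fderiv ℝ (b.normed μ) (x - y) v • f y ∂μ := by
  have hderiv : HasFDerivAt (mollify μ b f) _ x :=
    (b.hasCompactSupport_normed (μ := μ)).hasFDerivAt_convolution_left _ b.contDiff_normed
      hf.locallyIntegrable x
  have hint := ((b.hasCompactSupport_normed (μ := μ)).fderiv ℝ).convolutionExists_left
    (ContinuousLinearMap.precompL E (ContinuousLinearMap.lsmul ℝ ℝ))
    ((b.contDiff_normed (n := 1)).continuous_fderiv one_ne_zero) hf.locallyIntegrable x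
  rw [hderiv.fderiv, convolution_eq_swap, ContinuousLinearMap.integral_apply hint.integrable_swap]
  simp

variable [CompleteSpace F] {b : ℕ → ContDiffBump (0 : E)}

theorem ae_tendsto_mollify (hb : Tendsto (fun n => (b n).rOut) atTop (𝓝 0))
    (hb' : ∀ n, (b n).rOut ≤ 2 * (b n).rIn) (hf : Integrable f μ) :
    ∀ᵐ x ∂μ, Tendsto (fun n => mollify μ (b n) f x) atTop (𝓝 (f x)) :=
  ContDiffBump.ae_convolution_tendsto_right_of_locallyIntegrable hb (.of_forall hb')
    hf.locallyIntegrable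

theorem tendsto_integral_norm_mollify (hb : Tendsto (fun n => (b n).rOut) atTop (𝓝 0))
    (hb' : ∀ n, (b n).rOut ≤ 2 * (b n).rIn) (hf : Integrable f μ) :
    Tendsto (fun n => ∫ x, ‖mollify μ (b n) f x‖ ∂μ) atTop (𝓝 (∫ x, ‖f x‖ ∂μ)) :=
  tendsto_integral_of_integral_le (fun n => (integrable_mollify (b n) hf).norm) hf.norm
    (fun _ => .of_forall fun _ => norm_nonneg _)
    ((ae_tendsto_mollify hb hb' hf).mono fun _ hx => hx.norm)
    (fun n => integral_norm_mollify_le (b n) hf)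

end Mollify

section MollifyComp

variable {E F F' : Type*} [NormedAddCommGroup E] [NormedSpace ℝ E] [FiniteDimensional ℝ E]
  [HasContDiffBump E] [MeasurableSpace E] [BorelSpace E] {μ : Measure E} [μ.IsAddHaarMeasure]
  [NormedAddCommGroup F] [NormedSpace ℝ F] [CompleteSpace F]
  [NormedAddCommGroup F'] [NormedSpace ℝ F']

theorem tendsto_integral_smul_comp_mollify {b : ℕ → ContDiffBump (0 : E)}
    (hb : Tendsto (fun n => (b n).rOut) atTop (𝓝 0)) (hb' : ∀ n, (b n).rOut ≤ 2 * (b n).rIn)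
    {Ψ : F → F → F'} (hΨ : Continuous fun z : F × F => Ψ z.1 z.2) {C : ℝ}
    (hC : ∀ z w, ‖Ψ z w‖ ≤ C * ‖w‖) {u g : E → F} (hu : Integrable u μ) (hg : Integrable g μ)
    {η : E → ℝ} {M : ℝ} (hη : AEStronglyMeasurable η μ) (hM : ∀ x, ‖η x‖ ≤ M) :
    Tendsto (fun n => ∫ x, η x • Ψ (mollify μ (b n) u x) (mollify μ (b n) g x) ∂μ) atTop
      (𝓝 (∫ x, η x • Ψ (u x) (g x) ∂μ)) := by
  have hm : ∀ {u g : E → F}, Integrable u μ → Integrable g μ →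
      AEStronglyMeasurable (fun x => Ψ (u x) (g x)) μ := fun hu hg =>
    hΨ.comp_aestronglyMeasurable (hu.1.prodMk hg.1)
  have hi : ∀ {u g : E → F}, Integrable u μ → Integrable g μ →
      Integrable (fun x => Ψ (u x) (g x)) μ := fun hu hg =>
    (hg.norm.const_mul C).mono' (hm hu hg) (.of_forall fun x => hC _ _)
  have hun := fun n => integrable_mollify (b n) hu
  have hgn := fun n => integrable_mollify (b n) hg
  have hu_lim := ae_tendsto_mollify hb hb' hu
  have hg_lim := ae_tendsto_mollify hb hb' hg
  refine tendsto_integral_smul_of_tendsto_integral_norm_sub hη hM (fun n => hi (hun n) (hgn n))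
    (hi hu hg) ?_
  refine tendsto_integral_norm_sub_of_dominated (fun n => hm (hun n) (hgn n))
    (fun n => (hgn n).norm.const_mul C) (hg.norm.const_mul C) (fun n => .of_forall fun x => hC _ _)
    ?_ ?_ ?_
  · filter_upwards [hu_lim, hg_lim] with x hux hgx
    exact (hΨ.tendsto (u x, g x)).comp (hux.prodMk_nhds hgx)
  · filter_upwards [hg_lim] with x hgx
    exact hgx.norm.const_mul C
  · simpa only [integral_const_mul] using (tendsto_integral_norm_mollify hb hb' hg).const_mul C

end MollifyComp

section IntegrationByParts

variable {E F F' : Type*} [NormedAddCommGroup E] [NormedSpace ℝ E] [FiniteDimensional ℝ E]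
  [MeasurableSpace E] [BorelSpace E] {μ : Measure E} [μ.IsAddHaarMeasure]
  [NormedAddCommGroup F] [NormedSpace ℝ F] [NormedAddCommGroup F'] [NormedSpace ℝ F']

theorem integral_fderiv_smul_comp {W : E → F} (hW : ContDiff ℝ 1 W) {Φ : F → F'}
    (hΦ : ContDiff ℝ 1 Φ) {η : E → ℝ} (hη : ContDiff ℝ 1 η) (hηc : HasCompactSupport η) (v : E) :
    ∫ x, fderiv ℝ η x v • Φ (W x) ∂μ = -∫ x, η x • fderiv ℝ Φ (W x) (fderiv ℝ W x v) ∂μ := by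
  have hcomp : ContDiff ℝ 1 fun x => Φ (W x) := hΦ.comp hW
  have hchain : ∀ x, fderiv ℝ (fun x => Φ (W x)) x v = fderiv ℝ Φ (W x) (fderiv ℝ W x v) :=
    fun x => by
      rw [fderiv_fun_comp x (hΦ.differentiable one_ne_zero _) (hW.differentiable one_ne_zero x),
        ContinuousLinearMap.comp_apply]
  have hη' : Continuous fun x => fderiv ℝ η x v :=
    (hη.continuous_fderiv one_ne_zero).clm_apply continuous_const
  have hcomp' : Continuous fun x => fderiv ℝ (fun x => Φ (W x)) x v :=
    (hcomp.continuous_fderiv one_ne_zero).clm_apply continuous_const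
  simp only [← hchain]
  rw [eq_neg_iff_add_eq_zero, add_comm, ← eq_neg_iff_add_eq_zero]
  refine integral_smul_fderiv_eq_neg_fderiv_smul_of_integrable ?_ ?_ ?_
    (fun x _ => hη.differentiable one_ne_zero x) (fun x _ => hcomp.differentiable one_ne_zero x)
  · exact (hη'.smul hcomp.continuous).integrable_of_hasCompactSupport
      (hηc.fderiv_apply ℝ v).smul_right
  · exact (hη.continuous.smul hcomp').integrable_of_hasCompactSupport hηc.smul_right
  · exact (hη.continuous.smul hcomp.continuous).integrable_of_hasCompactSupport hηc.smul_right

end IntegrationByParts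

theorem norm_le_of_norm_fderiv_le {F F' : Type*} [NormedAddCommGroup F] [NormedSpace ℝ F]
    [NormedAddCommGroup F'] [NormedSpace ℝ F'] {Φ : F → F'} (hΦ : Differentiable ℝ Φ)
    (hΦ0 : Φ 0 = 0) {C : ℝ} (hC : ∀ z, ‖fderiv ℝ Φ z‖ ≤ C) (z : F) : ‖Φ z‖ ≤ C * ‖z‖ := by
  simpa only [hΦ0, sub_zero] using convex_univ.norm_image_sub_le_of_norm_fderiv_le (𝕜 := ℝ)
    (fun x _ => hΦ x) (fun x _ => hC x) (Set.mem_univ 0) (Set.mem_univ z)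

section MollifyChainRule

variable {E F F' : Type*} [NormedAddCommGroup E] [NormedSpace ℝ E] [FiniteDimensional ℝ E]
  [HasContDiffBump E] [MeasurableSpace E] [BorelSpace E] {μ : Measure E} [μ.IsAddHaarMeasure]
  [NormedAddCommGroup F] [NormedSpace ℝ F] [CompleteSpace F]
  [NormedAddCommGroup F'] [NormedSpace ℝ F']

theorem integral_fderiv_smul_comp_of_fderiv_mollify {b : ℕ → ContDiffBump (0 : E)}
    (hb : Tendsto (fun n => (b n).rOut) atTop (𝓝 0)) (hb' : ∀ n, (b n).rOut ≤ 2 * (b n).rIn)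
    {u g : E → F} (hu : Integrable u μ) (hg : Integrable g μ)
    {η : E → ℝ} (hη : ContDiff ℝ 1 η) (hηc : HasCompactSupport η) {v : E}
    (hug : ∀ n, ∀ x ∈ tsupport η, fderiv ℝ (mollify μ (b n) u) x v = mollify μ (b n) g x)
    {Φ : F → F'} (hΦ : ContDiff ℝ 1 Φ) (hΦ0 : Φ 0 = 0) {C : ℝ} (hC : ∀ z, ‖fderiv ℝ Φ z‖ ≤ C) :
    ∫ x, fderiv ℝ η x v • Φ (u x) ∂μ = -∫ x, η x • fderiv ℝ Φ (u x) (g x) ∂μ := by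
  have hη' : Continuous fun x => fderiv ℝ η x v :=
    (hη.continuous_fderiv one_ne_zero).clm_apply continuous_const
  obtain ⟨M, hM⟩ := hη.continuous.bounded_above_of_compact_support hηc
  obtain ⟨M', hM'⟩ := hη'.bounded_above_of_compact_support (hηc.fderiv_apply ℝ v)
  have hparts : ∀ n, ∫ x, fderiv ℝ η x v • Φ (mollify μ (b n) u x) ∂μ =
      -∫ x, η x • fderiv ℝ Φ (mollify μ (b n) u x) (mollify μ (b n) g x) ∂μ := fun n => by
    rw [integral_fderiv_smul_comp ((contDiff_mollify (b n) hu).of_le (by simp)) hΦ hη hηc]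
    congr 2; ext x
    by_cases hx : x ∈ tsupport η
    · rw [hug n x hx]
    · rw [image_eq_zero_of_notMem_tsupport hx, zero_smul, zero_smul]
  have hlim := tendsto_integral_smul_comp_mollify hb hb' (Ψ := fun _ z => Φ z)
    (hΦ.continuous.comp continuous_snd)
    (fun _ => norm_le_of_norm_fderiv_le (hΦ.differentiable one_ne_zero) hΦ0 hC) hu hu
    hη'.aestronglyMeasurable hM'
  have hlim' := tendsto_integral_smul_comp_mollify hb hb' (Ψ := fun z w => fderiv ℝ Φ z w)
    (((hΦ.continuous_fderiv one_ne_zero).comp continuous_fst).clm_apply continuous_snd)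
    (fun z => (fderiv ℝ Φ z).le_of_opNorm_le (hC z)) hu hg hη.continuous.aestronglyMeasurable hM
  exact tendsto_nhds_unique (hlim.congr hparts) hlim'.neg

end MollifyChainRule

section ChainRule

theorem integral_smul_eq_setIntegral {α F : Type*} [MeasurableSpace α] [NormedAddCommGroup F]
    [NormedSpace ℝ F] {μ : Measure α} {K s : Set α} (hKs : K ⊆ s) {η : α → ℝ}
    (hη : ∀ x ∉ K, η x = 0) {f g : α → F} (hfg : Set.EqOn f g K) :
    ∫ x, η x • f x ∂μ = ∫ x in s, η x • g x ∂μ := by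
  rw [setIntegral_eq_integral_of_forall_compl_eq_zero fun x hx => by
    rw [hη x fun hxK => hx (hKs hxK), zero_smul]]
  refine integral_congr_ae (.of_forall fun x => ?_)
  by_cases hx : x ∈ K
  · simp only [hfg hx]
  · simp only [hη x hx, zero_smul]

variable {d : ℕ} {Ω K : Set (Rd d)} {u : Rd d → ℂ} {g : Rd d → Cd d}

theorem IsWeakGradient.fderiv_mollify_indicator (hg : IsWeakGradient Ω u g)
    (hK : MeasurableSet K) (hKΩ : K ⊆ Ω) (hu : IntegrableOn u K) (b : ContDiffBump (0 : Rd d))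
    {x : Rd d} (hx : Metric.closedBall x b.rOut ⊆ K) (i : Fin d) :
    fderiv ℝ (mollify volume b (K.indicator u)) x (EuclideanSpace.single i 1) =
      mollify volume b (K.indicator fun y => g y i) x := by
  set v : Rd d := EuclideanSpace.single i 1
  let φ : Rd d → ℝ := fun y => b.normed volume (x - y)
  have hφ : ContDiff ℝ ∞ φ := b.contDiff_normed.comp (contDiff_const.sub contDiff_id)
  have hφ_supp : tsupport φ ⊆ Metric.closedBall x b.rOut := by
    refine closure_minimal (fun y hy => ?_) Metric.isClosed_closedBall
    have hxy : x - y ∈ Function.support (b.normed volume) := hy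
    rw [b.support_normed_eq, mem_ball_zero_iff] at hxy
    rw [Metric.mem_closedBall, dist_comm, dist_eq_norm]
    exact hxy.le
  have hφ_deriv : ∀ y, fderiv ℝ φ y v = -fderiv ℝ (b.normed volume) (x - y) v := fun y => by
    rw [fderiv_fun_comp y ((b.contDiff_normed (n := 1)).differentiable one_ne_zero _)
      (differentiableAt_fun_id.const_sub x), fderiv_const_sub]
    simp
  have hφK : ∀ y ∉ K, φ y = 0 ∧ fderiv ℝ φ y v = 0 := fun y hy => by
    have hy' : y ∉ tsupport φ := fun h => hy (hx (hφ_supp h))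
    exact ⟨image_eq_zero_of_notMem_tsupport hy', by rw [fderiv_of_notMem_tsupport ℝ hy']; rfl⟩
  have hweak := hg φ hφ
    ((isCompact_closedBall x b.rOut).of_isClosed_subset (isClosed_tsupport φ) hφ_supp)
    ((hφ_supp.trans hx).trans hKΩ) i
  rw [fderiv_mollify_apply b ((integrable_indicator_iff hK).2 hu), mollify_apply, ← neg_inj,
    ← integral_neg]
  simp only [← neg_smul, ← hφ_deriv]
  rw [integral_smul_eq_setIntegral hKΩ (fun y hy => (hφK y hy).2) (Set.eqOn_indicator),
    integral_smul_eq_setIntegral hKΩ (fun y hy => (hφK y hy).1) (Set.eqOn_indicator)]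
  exact hweak

/-- A real-linear map of `ℂ` acting on each coordinate of a complex vector. -/
noncomputable def mapCoord (L : ℂ →L[ℝ] ℂ) (ξ : Cd d) : Cd d :=
  WithLp.toLp 2 fun i => L (ξ i)

theorem IsWeakGradient.comp (hΩ : IsOpen Ω) (hg : IsWeakGradient Ω u g)
    (hu : LocallyIntegrableOn u Ω) (hgi : ∀ i, LocallyIntegrableOn (fun x => g x i) Ω)
    {Φ : ℂ → ℂ} (hΦ : ContDiff ℝ 1 Φ) (hΦ0 : Φ 0 = 0) {C : ℝ} (hC : ∀ z, ‖fderiv ℝ Φ z‖ ≤ C) :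
    IsWeakGradient Ω (fun x => Φ (u x)) fun x => mapCoord (fderiv ℝ Φ (u x)) (g x) := by
  intro η hη hηc hηΩ i
  set v : Rd d := EuclideanSpace.single i 1
  obtain ⟨δ, hδ, hδΩ⟩ := hηc.isCompact.exists_cthickening_subset_open hΩ hηΩ
  obtain ⟨b, hb, hb', hbδ⟩ := exists_contDiffBump_seq (E := Rd d) hδ
  set K := Metric.cthickening δ (tsupport η)
  have hK : IsCompact K := hηc.isCompact.cthickening
  have hηK : ∀ x ∉ K, x ∉ tsupport η := fun x hx h => hx (Metric.self_subset_cthickening _ h)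
  have huK : IntegrableOn u K := hu.integrableOn_compact_subset hδΩ hK
  have hgK : IntegrableOn (fun x => g x i) K := (hgi i).integrableOn_compact_subset hδΩ hK
  have hchain := integral_fderiv_smul_comp_of_fderiv_mollify hb hb'
    ((integrable_indicator_iff hK.measurableSet).2 huK)
    ((integrable_indicator_iff hK.measurableSet).2 hgK) (hη.of_le (by simp)) hηc
    (fun n x hx => hg.fderiv_mollify_indicator hK.measurableSet hδΩ huK (b n)
      ((Metric.closedBall_subset_cthickening hx _).trans (Metric.cthickening_mono (hbδ n) _)) i)
    hΦ hΦ0 hC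
  rwa [integral_smul_eq_setIntegral hδΩ (g := fun x => Φ (u x))
      (fun x hx => by rw [fderiv_of_notMem_tsupport ℝ (hηK x hx)]; rfl)
      (fun x hx => by simp only [Set.indicator_of_mem hx]),
    integral_smul_eq_setIntegral hδΩ (g := fun x => mapCoord (fderiv ℝ Φ (u x)) (g x) i)
      (fun x hx => image_eq_zero_of_notMem_tsupport (hηK x hx))
      (fun x hx => by simp only [Set.indicator_of_mem hx]; rfl)] at hchain

theorem IsWeakGradient.congr_ae {u' : Rd d → ℂ} {g' : Rd d → Cd d} (hg : IsWeakGradient Ω u g)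
    (hu : u =ᵐ[volume.restrict Ω] u') (hgg : g =ᵐ[volume.restrict Ω] g') :
    IsWeakGradient Ω u' g' := fun φ hφ hφc hφs i => by
  rw [← integral_congr_ae (hu.mono fun x hx => congrArg (fderiv ℝ φ x _ • ·) hx),
    ← integral_congr_ae (hgg.mono fun x hx => congrArg (φ x • · i) hx)]
  exact hg φ hφ hφc hφs i

end ChainRule

section PairLp

variable {α E F : Type*} [MeasurableSpace α] {μ : Measure α} [NormedAddCommGroup E]
  [NormedSpace ℝ E] [NormedAddCommGroup F] [NormedSpace ℝ F] {p : ℝ≥0∞} [Fact (1 ≤ p)]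

/-- The pairing `(f, g) ↦ (x ↦ (f x, g x))` as a continuous linear map into `L^p(μ; E × F)`. -/
noncomputable def pairLp (p : ℝ≥0∞) [Fact (1 ≤ p)] (μ : Measure α) :
    Lp E p μ × Lp F p μ →L[ℝ] Lp (E × F) p μ :=
  ((ContinuousLinearMap.inl ℝ E F).compLpL p μ).coprod
    ((ContinuousLinearMap.inr ℝ E F).compLpL p μ)

theorem coeFn_pairLp (w : Lp E p μ × Lp F p μ) :
    pairLp p μ w =ᵐ[μ] fun x => (w.1 x, w.2 x) := by
  filter_upwards [Lp.coeFn_add ((ContinuousLinearMap.inl ℝ E F).compLpL p μ w.1)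
      ((ContinuousLinearMap.inr ℝ E F).compLpL p μ w.2),
    (ContinuousLinearMap.inl ℝ E F).coeFn_compLpL w.1,
    (ContinuousLinearMap.inr ℝ E F).coeFn_compLpL w.2] with x hadd hl hr
  rw [pairLp, ContinuousLinearMap.coprod_apply, hadd, Pi.add_apply, hl, hr]
  simp

end PairLp

section Superposition

variable {d : ℕ}

theorem norm_mapCoord_le {L : ℂ →L[ℝ] ℂ} {C : ℝ} (hL : ‖L‖ ≤ C) (ξ : Cd d) :
    ‖mapCoord L ξ‖ ≤ C * ‖ξ‖ := by
  have hC : 0 ≤ C := (norm_nonneg _).trans hL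
  rw [EuclideanSpace.norm_eq, EuclideanSpace.norm_eq, ← Real.sqrt_sq hC,
    ← Real.sqrt_mul (by positivity), Finset.mul_sum]
  refine Real.sqrt_le_sqrt (Finset.sum_le_sum fun i _ => ?_)
  rw [← mul_pow]
  exact pow_le_pow_left₀ (norm_nonneg _) (L.le_of_opNorm_le hL _) 2

theorem continuous_mapCoord_fderiv {Φ : ℂ → ℂ} (hΦ : ContDiff ℝ 1 Φ) :
    Continuous fun z : ℂ × Cd d => mapCoord (fderiv ℝ Φ z.1) z.2 := by
  refine (PiLp.continuous_toLp 2 _).comp (continuous_pi fun i => ?_)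
  exact ((hΦ.continuous_fderiv one_ne_zero).comp continuous_fst).clm_apply
    ((EuclideanSpace.proj (𝕜 := ℂ) i).continuous.comp continuous_snd)

/-- The functions that operate by superposition on the form domains: smooth, zero at the origin,
with derivative bounded by `C`. -/
structure OperatesOnSobolev (Φ : ℂ → ℂ) (C : ℝ) : Prop where
  contDiff : ContDiff ℝ ∞ Φ
  map_zero : Φ 0 = 0
  norm_fderiv_le : ∀ z, ‖fderiv ℝ Φ z‖ ≤ C

namespace OperatesOnSobolev

variable {Ω D : Set (Rd d)} {Φ : ℂ → ℂ} {C : ℝ}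

theorem contDiff_one (hΦ : OperatesOnSobolev Φ C) : ContDiff ℝ 1 Φ := hΦ.contDiff.of_le (by simp)

theorem norm_comp_fst_le (hΦ : OperatesOnSobolev Φ C) (z : ℂ × Cd d) :
    ‖Φ z.1‖ ≤ C * ‖z‖ ^ (ENNReal.toReal 2 / ENNReal.toReal 2) := by
  rw [div_self (by simp), Real.rpow_one]
  exact (norm_le_of_norm_fderiv_le (hΦ.contDiff.differentiable (by simp)) hΦ.map_zero
    hΦ.norm_fderiv_le z.1).trans (mul_le_mul_of_nonneg_left (norm_fst_le z)
      ((norm_nonneg _).trans (hΦ.norm_fderiv_le 0)))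

theorem norm_mapCoord_fderiv_le (hΦ : OperatesOnSobolev Φ C) (z : ℂ × Cd d) :
    ‖mapCoord (fderiv ℝ Φ z.1) z.2‖ ≤ C * ‖z‖ ^ (ENNReal.toReal 2 / ENNReal.toReal 2) := by
  rw [div_self (by simp), Real.rpow_one]
  exact (norm_mapCoord_le (hΦ.norm_fderiv_le z.1) z.2).trans
    (mul_le_mul_of_nonneg_left (norm_snd_le z) ((norm_nonneg _).trans (hΦ.norm_fderiv_le 0)))

/-- The pair `(Φ ∘ u, DΦ(u) ∇u)`, for an element of `L^2(Ω) × L^2(Ω; ℂ^d)` written `(u, ∇u)`. -/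
noncomputable def superpose (hΦ : OperatesOnSobolev Φ C) (w : LpΩ 2 Ω × L2Field Ω) :
    LpΩ 2 Ω × L2Field Ω :=
  (nemytskii (hΦ.contDiff.continuous.comp continuous_fst) ENNReal.ofNat_ne_top
      ENNReal.ofNat_ne_top hΦ.norm_comp_fst_le (pairLp 2 _ w),
    nemytskii (continuous_mapCoord_fderiv hΦ.contDiff_one) ENNReal.ofNat_ne_top
      ENNReal.ofNat_ne_top hΦ.norm_mapCoord_fderiv_le (pairLp 2 _ w))

theorem continuous_superpose (hΦ : OperatesOnSobolev Φ C) :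
    Continuous (hΦ.superpose (Ω := Ω)) :=
  ((continuous_nemytskii _ _ _ _).comp (pairLp 2 _).continuous).prodMk
    ((continuous_nemytskii _ _ _ _).comp (pairLp 2 _).continuous)

theorem coeFn_superpose_fst (hΦ : OperatesOnSobolev Φ C) (w : LpΩ 2 Ω × L2Field Ω) :
    (hΦ.superpose w).1 =ᵐ[volume.restrict Ω] fun x => Φ (w.1 x) := by
  filter_upwards [coeFn_nemytskii (hΦ.contDiff.continuous.comp continuous_fst)
    ENNReal.ofNat_ne_top ENNReal.ofNat_ne_top hΦ.norm_comp_fst_le (pairLp 2 _ w), coeFn_pairLp w]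
    with x hx hw
  rw [superpose, hx, Function.comp_apply, hw]

theorem coeFn_superpose_snd (hΦ : OperatesOnSobolev Φ C) (w : LpΩ 2 Ω × L2Field Ω) :
    (hΦ.superpose w).2 =ᵐ[volume.restrict Ω] fun x => mapCoord (fderiv ℝ Φ (w.1 x)) (w.2 x) := by
  filter_upwards [coeFn_nemytskii (continuous_mapCoord_fderiv hΦ.contDiff_one)
    ENNReal.ofNat_ne_top ENNReal.ofNat_ne_top hΦ.norm_mapCoord_fderiv_le (pairLp 2 _ w),
    coeFn_pairLp w] with x hx hw
  rw [superpose, hx, hw]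

theorem superpose_mem_W12 (hΦ : OperatesOnSobolev Φ C) (hΩ : IsOpen Ω)
    {w : LpΩ 2 Ω × L2Field Ω} (hw : w ∈ W12 Ω) : hΦ.superpose w ∈ W12 Ω := by
  have hu : LocallyIntegrableOn w.1 Ω :=
    locallyIntegrableOn_of_locallyIntegrable_restrict ((Lp.memLp w.1).locallyIntegrable one_le_two)
  have hg : ∀ i, LocallyIntegrableOn (fun x => w.2 x i) Ω := fun i =>
    locallyIntegrableOn_of_locallyIntegrable_restrict
      (((EuclideanSpace.proj (𝕜 := ℂ) i).comp_memLp' (Lp.memLp w.2)).locallyIntegrable one_le_two)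
  exact (IsWeakGradient.comp hΩ hw hu hg hΦ.contDiff_one hΦ.map_zero hΦ.norm_fderiv_le).congr_ae
    (hΦ.coeFn_superpose_fst w).symm (hΦ.coeFn_superpose_snd w).symm

theorem superpose_mem_smoothD (hΦ : OperatesOnSobolev Φ C) (hΩ : IsOpen Ω)
    {w : LpΩ 2 Ω × L2Field Ω} (hw : w ∈ smoothD Ω D) : hΦ.superpose w ∈ smoothD Ω D := by
  obtain ⟨hw, φ, hφ, hφc, hφD, hwφ⟩ := hw
  have hsupp : tsupport (Φ ∘ φ) ⊆ tsupport φ :=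
    closure_mono (Function.support_comp_subset hΦ.map_zero φ)
  refine ⟨hΦ.superpose_mem_W12 hΩ hw, Φ ∘ φ, hΦ.contDiff.comp hφ, hφc.comp_left hΦ.map_zero,
    hφD.mono_left hsupp, ?_⟩
  filter_upwards [hΦ.coeFn_superpose_fst w, hwφ] with x hx hx'
  rw [hx, hx', Function.comp_apply]

theorem superpose_mem_sobolevD (hΦ : OperatesOnSobolev Φ C) (hΩ : IsOpen Ω)
    {w : LpΩ 2 Ω × L2Field Ω} (hw : w ∈ sobolevD Ω D) : hΦ.superpose w ∈ sobolevD Ω D := by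
  refine ⟨hΦ.superpose_mem_W12 hΩ hw.1, hw.2.mono_left fun x hx U hU h0 => hx U hU ?_⟩
  filter_upwards [hΦ.coeFn_superpose_fst w, h0] with y hy hy' hyU
  rw [hy, hy' hyU, hΦ.map_zero]

theorem superpose_mem_formDomain (hΦ : OperatesOnSobolev Φ C) (hΩ : IsOpen Ω)
    {V : Set (LpΩ 2 Ω × L2Field Ω)} (hV : IsFormDomain Ω D V) {w : LpΩ 2 Ω × L2Field Ω}
    (hw : w ∈ V) : hΦ.superpose w ∈ V := by
  rcases hV with rfl | rfl
  · exact ⟨hΦ.superpose_mem_W12 hΩ hw.1, map_mem_closure hΦ.continuous_superpose hw.2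
      fun _ => hΦ.superpose_mem_smoothD hΩ⟩
  · exact ⟨hΦ.superpose_mem_W12 hΩ hw.1, map_mem_closure hΦ.continuous_superpose hw.2
      fun _ => hΦ.superpose_mem_sobolevD hΩ⟩

end OperatesOnSobolev

end Superposition

/-! ### Regularization of the duality map -/

section PowerMap

/-- The function `z ↦ |z|^(p - 2) z`, which maps `u ∈ L^p` to a multiple of its norming functional
in `L^p'`. -/
noncomputable def powerMap (p : ℝ) (z : ℂ) : ℂ := ‖z‖ ^ (p - 2) • z

variable {p : ℝ}

theorem norm_powerMap (hp : 1 < p) (z : ℂ) : ‖powerMap p z‖ = ‖z‖ ^ (p - 1) := by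
  rw [powerMap, norm_smul, Real.norm_of_nonneg (by positivity)]
  rcases eq_or_ne z 0 with rfl | hz
  · simp [Real.zero_rpow (sub_pos.2 hp).ne']
  · rw [← Real.rpow_add_one (norm_ne_zero_iff.2 hz)]
    ring_nf

theorem conj_powerMap_mul_self (hp : 1 < p) (z : ℂ) :
    starRingEnd ℂ (powerMap p z) * z = ((‖z‖ ^ p : ℝ) : ℂ) := by
  rcases eq_or_ne z 0 with rfl | hz
  · simp [Real.zero_rpow (zero_lt_one.trans hp).ne']
  · rw [powerMap, Complex.real_smul, map_mul, Complex.conj_ofReal, mul_assoc, Complex.conj_mul',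
      ← Complex.ofReal_pow, ← Complex.ofReal_mul, ← Real.rpow_natCast,
      ← Real.rpow_add (norm_pos_iff.2 hz)]
    norm_num

theorem continuous_powerMap (hp : 1 < p) : Continuous (powerMap p) := by
  refine continuous_iff_continuousAt.2 fun z => ?_
  rcases eq_or_ne z 0 with rfl | hz
  · have hlim : Tendsto (fun z : ℂ => ‖z‖ ^ (p - 1)) (𝓝 0) (𝓝 0) := by
      simpa [Real.zero_rpow (sub_pos.2 hp).ne'] using
        (tendsto_norm_zero (E := ℂ)).rpow_const (.inr (sub_pos.2 hp).le)
    rw [ContinuousAt, powerMap, smul_zero]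
    exact squeeze_zero_norm (fun w => (norm_powerMap hp w).le) hlim
  · exact (continuous_norm.continuousAt.rpow_const (.inl (norm_ne_zero_iff.2 hz))).smul
      continuousAt_id

end PowerMap

section RegRatio

/-- For `0 < ε ≤ 1` and `q ≥ 0`, a smooth approximation of `q` with values in `[ε, ε⁻¹]`. -/
noncomputable def regRatio (ε q : ℝ) : ℝ := (ε + q) / (1 + ε * q)

variable {ε q : ℝ}

theorem regRatio_pos (hε : 0 < ε) (hq : 0 ≤ q) : 0 < regRatio ε q := by
  unfold regRatio
  positivity

theorem regRatio_mem_uIcc_one_self (hε : 0 < ε) (hε1 : ε ≤ 1) (hq : 0 ≤ q) :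
    regRatio ε q ∈ Set.uIcc 1 q := by
  have h : 0 < 1 + ε * q := by positivity
  rw [Set.mem_uIcc, regRatio, le_div_iff₀ h, div_le_iff₀ h, le_div_iff₀ h, div_le_iff₀ h]
  rcases le_total 1 q with hq1 | hq1
  · have hq2 : ε * 1 ≤ ε * q ^ 2 := by gcongr; exact one_le_pow₀ hq1
    exact .inl ⟨by nlinarith, by linarith⟩
  · have hq2 : ε * q ^ 2 ≤ ε * 1 := by gcongr; exact pow_le_one₀ hq hq1
    exact .inr ⟨by linarith, by nlinarith⟩

theorem regRatio_mem_uIcc_inv (hε : 0 < ε) (hε1 : ε ≤ 1) (hq : 0 ≤ q) :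
    regRatio ε q ∈ Set.uIcc ε ε⁻¹ := by
  have h : 0 < 1 + ε * q := by positivity
  refine Set.mem_uIcc.2 (.inl ⟨?_, ?_⟩)
  · rw [regRatio, le_div_iff₀ h]
    nlinarith [mul_nonneg (sub_nonneg.2 hε1) hq, mul_nonneg hε.le hq]
  · rw [regRatio, div_le_iff₀ h, mul_add, inv_mul_cancel_left₀ hε.ne', mul_one]
    gcongr
    exact hε1.trans (one_le_inv_iff₀.2 ⟨hε, hε1⟩)

theorem hasDerivAt_regRatio (hε : 0 < ε) (hq : 0 ≤ q) :
    HasDerivAt (regRatio ε) ((1 - ε ^ 2) / (1 + ε * q) ^ 2) q := by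
  have h : 1 + ε * q ≠ 0 := by positivity
  refine (((hasDerivAt_id q).const_add ε).fun_div
    (((hasDerivAt_id q).const_mul ε).const_add 1) h).congr_deriv ?_
  simp only [id]
  ring

theorem logDeriv_regRatio (hε : 0 < ε) (hq : 0 ≤ q) :
    logDeriv (regRatio ε) q = (1 - ε ^ 2) / ((1 + ε * q) * (ε + q)) := by
  rw [logDeriv_apply, (hasDerivAt_regRatio hε hq).deriv, regRatio]
  field_simp

theorem logDeriv_regRatio_nonneg (hε : 0 < ε) (hε1 : ε ≤ 1) (hq : 0 ≤ q) :
    0 ≤ logDeriv (regRatio ε) q := by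
  rw [logDeriv_regRatio hε hq]
  have : 0 ≤ 1 - ε ^ 2 := sub_nonneg.2 (pow_le_one₀ hε.le hε1)
  positivity

theorem logDeriv_regRatio_mul_le_one (hε : 0 < ε) (hq : 0 ≤ q) :
    logDeriv (regRatio ε) q * q ≤ 1 := by
  rw [logDeriv_regRatio hε hq, div_mul_eq_mul_div, div_le_one (by positivity)]
  have : 0 ≤ ε + ε * q ^ 2 + 2 * ε ^ 2 * q := by positivity
  linarith

theorem rpow_le_add_of_mem_uIcc {a b x : ℝ} (ha : 0 < a) (hb : 0 < b) (hx : x ∈ Set.uIcc a b)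
    (s : ℝ) : x ^ s ≤ a ^ s + b ^ s := by
  wlog hab : a ≤ b generalizing a b
  · rw [add_comm]
    exact this hb ha (Set.uIcc_comm a b ▸ hx) (le_of_not_ge hab)
  rw [Set.uIcc_of_le hab] at hx
  rcases le_total 0 s with hs | hs
  · exact (Real.rpow_le_rpow (ha.le.trans hx.1) hx.2 hs).trans
      (le_add_of_nonneg_left (by positivity))
  · exact (Real.rpow_le_rpow_of_nonpos ha hx.1 hs).trans (le_add_of_nonneg_right (by positivity))

end RegRatio

section RegPower

/-- A smooth approximation of `powerMap p` with bounded derivative, for `0 < ε ≤ 1`. -/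
noncomputable def regPower (p ε : ℝ) (z : ℂ) : ℂ := regRatio ε (‖z‖ ^ 2) ^ ((p - 2) / 2) • z

theorem regPower_apply_zero (p ε : ℝ) : regPower p ε 0 = 0 := smul_zero _

theorem contDiff_regPower (p : ℝ) {ε : ℝ} (hε : 0 < ε) : ContDiff ℝ ∞ (regPower p ε) := by
  have hsq : ContDiff ℝ ∞ fun z : ℂ => ‖z‖ ^ 2 := contDiff_norm_sq ℝ
  have hratio : ContDiff ℝ ∞ fun z : ℂ => regRatio ε (‖z‖ ^ 2) :=
    (contDiff_const.add hsq).div (contDiff_const.add (contDiff_const.mul hsq))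
      fun z => by positivity
  exact (hratio.rpow_const_of_ne fun z => (regRatio_pos hε (by positivity)).ne').smul contDiff_id

theorem fderiv_comp_norm_sq_smul {E : Type*} [NormedAddCommGroup E] [InnerProductSpace ℝ E]
    {r : ℝ → ℝ} {r' : ℝ} {z : E} (hr : HasDerivAt r r' (‖z‖ ^ 2)) (h : E) :
    fderiv ℝ (fun z => r (‖z‖ ^ 2) • z) z h = r (‖z‖ ^ 2) • h + (2 * r' * inner ℝ z h) • z := by
  have hz : HasFDerivAt (fun z : E => r (‖z‖ ^ 2) • z) _ z :=
    (hr.comp_hasFDerivAt z (hasStrictFDerivAt_norm_sq z).hasFDerivAt).smul (hasFDerivAt_id z)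
  rw [hz.fderiv]
  simp only [Function.comp_apply, add_apply, smul_apply, ContinuousLinearMap.id_apply,
    ContinuousLinearMap.smulRight_apply, coe_innerSL_apply, nsmul_eq_mul, Nat.cast_ofNat,
    smul_eq_mul, add_right_inj]
  ring_nf

variable {p ε : ℝ}

theorem fderiv_regPower_apply (p : ℝ) (hε : 0 < ε) (z h : ℂ) :
    fderiv ℝ (regPower p ε) z h = regRatio ε (‖z‖ ^ 2) ^ ((p - 2) / 2) •
      (h + ((p - 2) * logDeriv (regRatio ε) (‖z‖ ^ 2) * inner ℝ z h) • z) := by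
  have hq : 0 ≤ ‖z‖ ^ 2 := by positivity
  have hratio := regRatio_pos hε hq
  have hr := (hasDerivAt_regRatio hε hq).differentiableAt.hasDerivAt.rpow_const
    (p := (p - 2) / 2) (.inl hratio.ne')
  rw [show regPower p ε = fun z => regRatio ε (‖z‖ ^ 2) ^ ((p - 2) / 2) • z from rfl,
    fderiv_comp_norm_sq_smul hr, smul_add, smul_smul, logDeriv_apply,
    Real.rpow_sub_one hratio.ne']
  congr 2
  field_simp

theorem norm_fderiv_regPower_le (p : ℝ) (hε : 0 < ε) (hε1 : ε ≤ 1) (z : ℂ) :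
    ‖fderiv ℝ (regPower p ε) z‖ ≤
      (ε ^ ((p - 2) / 2) + ε⁻¹ ^ ((p - 2) / 2)) * (1 + |p - 2|) := by
  have hq : 0 ≤ ‖z‖ ^ 2 := by positivity
  set κ := logDeriv (regRatio ε) (‖z‖ ^ 2)
  have hκ : 0 ≤ κ := logDeriv_regRatio_nonneg hε hε1 hq
  refine ContinuousLinearMap.opNorm_le_bound _ (by positivity) fun h => ?_
  rw [fderiv_regPower_apply p hε, norm_smul, mul_assoc _ (1 + |p - 2|),
    Real.norm_of_nonneg (Real.rpow_nonneg (regRatio_pos hε hq).le _)]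
  refine mul_le_mul (rpow_le_add_of_mem_uIcc hε (inv_pos.2 hε) (regRatio_mem_uIcc_inv hε hε1 hq) _)
    ?_ (norm_nonneg _) (by positivity)
  calc ‖h + ((p - 2) * κ * inner ℝ z h) • z‖
      ≤ ‖h‖ + |p - 2| * κ * |inner ℝ z h| * ‖z‖ := by
        refine (norm_add_le _ _).trans_eq ?_
        rw [norm_smul, Real.norm_eq_abs, abs_mul, abs_mul, abs_of_nonneg hκ]
    _ ≤ ‖h‖ + |p - 2| * κ * (‖z‖ * ‖h‖) * ‖z‖ := by
        gcongr
        exact abs_real_inner_le_norm z h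
    _ = ‖h‖ + |p - 2| * (κ * ‖z‖ ^ 2) * ‖h‖ := by ring
    _ ≤ ‖h‖ + |p - 2| * 1 * ‖h‖ := by
        gcongr
        exact logDeriv_regRatio_mul_le_one hε hq
    _ = (1 + |p - 2|) * ‖h‖ := by ring

theorem operatesOnSobolev_regPower (p : ℝ) (hε : 0 < ε) (hε1 : ε ≤ 1) :
    OperatesOnSobolev (regPower p ε)
      ((ε ^ ((p - 2) / 2) + ε⁻¹ ^ ((p - 2) / 2)) * (1 + |p - 2|)) where
  contDiff := contDiff_regPower p hε
  map_zero := regPower_apply_zero p ε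
  norm_fderiv_le := norm_fderiv_regPower_le p hε hε1

theorem norm_sq_rpow_half (z : ℂ) (s : ℝ) : (‖z‖ ^ 2) ^ (s / 2) = ‖z‖ ^ s := by
  rw [← Real.rpow_natCast_mul (norm_nonneg z), Nat.cast_ofNat, mul_div_cancel₀ s two_ne_zero]

theorem norm_regPower_le (p : ℝ) (hε : 0 < ε) (hε1 : ε ≤ 1) (z : ℂ) :
    ‖regPower p ε z‖ ≤ ‖z‖ + ‖powerMap p z‖ := by
  rcases eq_or_ne z 0 with rfl | hz
  · simp [regPower_apply_zero]
  have hq : 0 < ‖z‖ ^ 2 := by positivity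
  have hle := rpow_le_add_of_mem_uIcc one_pos hq (regRatio_mem_uIcc_one_self hε hε1 hq.le)
    ((p - 2) / 2)
  rw [Real.one_rpow, norm_sq_rpow_half] at hle
  rw [regPower, powerMap, norm_smul, norm_smul,
    Real.norm_of_nonneg (Real.rpow_nonneg (regRatio_pos hε hq.le).le _),
    Real.norm_of_nonneg (by positivity : 0 ≤ ‖z‖ ^ (p - 2))]
  exact (mul_le_mul_of_nonneg_right hle (norm_nonneg z)).trans_eq (by ring)

theorem tendsto_regPower (p : ℝ) (z : ℂ) :
    Tendsto (fun ε => regPower p ε z) (𝓝 0) (𝓝 (powerMap p z)) := by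
  rcases eq_or_ne z 0 with rfl | hz
  · simp [regPower, powerMap]
  have hratio : Tendsto (fun ε => regRatio ε (‖z‖ ^ 2)) (𝓝 0) (𝓝 (‖z‖ ^ 2)) := by
    have : ContinuousAt (fun ε => regRatio ε (‖z‖ ^ 2)) 0 := by
      unfold regRatio
      fun_prop (disch := simp)
    simpa [ContinuousAt, regRatio] using this
  rw [powerMap, ← norm_sq_rpow_half]
  exact (hratio.rpow_const (.inl (by positivity))).smul_const z

end RegPower

/-! ### Testing the form -/

section FormTest

variable {d : ℕ} {p ε θ : ℝ} {c : ℂ} {L : Cd d →L[ℂ] Cd d}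

theorem Jp_apply (hp : p ≠ 0) (ξ : Cd d) (i : Fin d) :
    Jp p ξ i = (2 / p : ℝ) • (ξ i + ((p - 2) * (ξ i).re : ℝ)) := by
  apply Complex.ext
  · simp [Jp, Real.conjExponent]
    field_simp
    ring
  · simp [Jp]
    ring

theorem Jp_ofReal_smul (p r : ℝ) (ξ : Cd d) : Jp p ((r : ℂ) • ξ) = (r : ℂ) • Jp p ξ := by
  ext i
  apply Complex.ext <;>
    simp only [Jp, Complex.coe_smul, PiLp.smul_apply, Complex.real_smul, Complex.mul_re,
      Complex.ofReal_re, Complex.ofReal_im, zero_mul, sub_zero, Complex.mul_im, add_zero] <;>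
    ring

theorem re_mul_inner_Jp_nonneg (hθ : 0 ≤ θ) (hθ' : θ ≤ Real.pi / 2)
    (hL : pNumericalRange p L ⊆ sector θ) (hc : c ∈ sector (Real.pi / 2 - θ)) (ξ : Cd d) :
    0 ≤ (c * inner ℂ (Jp p ξ) (L ξ)).re := by
  have hsphere : ∀ η : Cd d, ‖η‖ = 1 → 0 ≤ (c * inner ℂ (Jp p η) (L η)).re := fun η hη =>
    (mem_sector_iff_forall_mem_sector hθ hθ').1 (hL ⟨η, hη, rfl⟩) c hc
  rcases eq_or_ne ξ 0 with rfl | hξ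
  · simp
  have hscale : inner ℂ (Jp p ξ) (L ξ) = ((‖ξ‖ ^ 2 : ℝ) : ℂ) *
      inner ℂ (Jp p (((‖ξ‖⁻¹ : ℝ) : ℂ) • ξ)) (L (((‖ξ‖⁻¹ : ℝ) : ℂ) • ξ)) := by
    have : (‖ξ‖ : ℂ) ≠ 0 := by exact_mod_cast norm_ne_zero_iff.2 hξ
    rw [Jp_ofReal_smul, map_smul, inner_smul_left, inner_smul_right, Complex.conj_ofReal]
    push_cast
    field_simp
  rw [hscale, mul_left_comm, Complex.re_ofReal_mul]
  exact mul_nonneg (by positivity) (hsphere _ (by simp [norm_smul, hξ]))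

theorem inner_smul_Jp_conj_smul (p : ℝ) (L : Cd d →L[ℂ] Cd d) (s : ℂ) (ξ : Cd d) :
    inner ℂ (s • Jp p (starRingEnd ℂ s • ξ)) (L ξ) =
      inner ℂ (Jp p (starRingEnd ℂ s • ξ)) (L (starRingEnd ℂ s • ξ)) := by
  rw [inner_smul_left, map_smul, inner_smul_right]

theorem Jp_add_neg_I_smul_Jp (hp : p ≠ 0) (ξ : Cd d) :
    Jp p ξ + (-Complex.I) • Jp p (starRingEnd ℂ (-Complex.I) • ξ) = (2 : ℝ) • ξ := by
  ext i
  simp only [PiLp.add_apply, PiLp.smul_apply, Jp_apply hp]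
  apply Complex.ext <;> simp <;> field_simp <;> ring

theorem mapCoord_fderiv_regPower (hp : p ≠ 0) (hε : 0 < ε) (z : ℂ) (ξ : Cd d) :
    mapCoord (fderiv ℝ (regPower p ε) z) ξ = regRatio ε (‖z‖ ^ 2) ^ ((p - 2) / 2) •
      (((1 - logDeriv (regRatio ε) (‖z‖ ^ 2) * ‖z‖ ^ 2) / 2) •
          (Jp p ξ + (-Complex.I) • Jp p (starRingEnd ℂ (-Complex.I) • ξ)) +
        (logDeriv (regRatio ε) (‖z‖ ^ 2) * (p / 2)) • z • Jp p (starRingEnd ℂ z • ξ)) := by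
  rw [Jp_add_neg_I_smul_Jp hp]
  ext i
  simp only [mapCoord, fderiv_regPower_apply p hε, PiLp.add_apply, PiLp.smul_apply, Jp_apply hp]
  have hpc : (p : ℂ) ≠ 0 := Complex.ofReal_ne_zero.2 hp
  rw [Complex.inner]
  simp only [Complex.real_smul, smul_eq_mul]
  push_cast
  field_simp
  rw [← Complex.mul_conj']
  ring

theorem re_mul_inner_mapCoord_fderiv_regPower_nonneg (hp : 0 < p)
    (hL : ∀ ξ, 0 ≤ (c * inner ℂ (Jp p ξ) (L ξ)).re) (hε : 0 < ε) (hε1 : ε ≤ 1) (z : ℂ)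
    (ξ : Cd d) : 0 ≤ (c * inner ℂ (mapCoord (fderiv ℝ (regPower p ε) z) ξ) (L ξ)).re := by
  have hq : 0 ≤ ‖z‖ ^ 2 := by positivity
  have hrot : ∀ s : ℂ, 0 ≤ (c * inner ℂ (s • Jp p (starRingEnd ℂ s • ξ)) (L ξ)).re := fun s => by
    rw [inner_smul_Jp_conj_smul]
    exact hL _
  have hκ := logDeriv_regRatio_nonneg hε hε1 hq
  have hκ1 : 0 ≤ 1 - logDeriv (regRatio ε) (‖z‖ ^ 2) * ‖z‖ ^ 2 :=
    sub_nonneg.2 (logDeriv_regRatio_mul_le_one hε hq)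
  have hW := Real.rpow_nonneg (regRatio_pos hε hq).le ((p - 2) / 2)
  have hsmul : ∀ (r : ℝ) (η : Cd d), (c * inner ℂ (r • η) (L ξ)).re =
      r * (c * inner ℂ η (L ξ)).re := fun r η => by
    rw [RCLike.real_smul_eq_coe_smul (K := ℂ), inner_smul_left, RCLike.conj_ofReal, mul_left_comm]
    exact Complex.re_ofReal_mul _ _
  simp only [mapCoord_fderiv_regPower hp.ne' hε, hsmul, inner_add_left, mul_add, Complex.add_re]
  have := hL ξ
  have := hrot z
  have := hrot (-Complex.I)
  positivity

theorem re_mul_integral_nonneg {α : Type*} [MeasurableSpace α] {ν : Measure α} {F : α → ℂ}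
    {c : ℂ} (h : ∀ᵐ x ∂ν, 0 ≤ (c * F x).re) : 0 ≤ (c * ∫ x, F x ∂ν).re := by
  by_cases hF : Integrable F ν
  · rw [← integral_const_mul, ← RCLike.re_eq_complex_re, ← integral_re (hF.const_mul c)]
    exact integral_nonneg_of_ae h
  · simp [integral_undef hF]

theorem re_mul_integral_conj_regPower_mul_nonneg {Ω D : Set (Rd d)} (hΩ : IsOpen Ω)
    {V : Set (LpΩ 2 Ω × L2Field Ω)} (hV : IsFormDomain Ω D V) {μ : Rd d → Cd d →L[ℂ] Cd d}
    (hp : 0 < p)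
    (hμ : ∀ᵐ x ∂(volume.restrict Ω), ∀ ξ, 0 ≤ (c * inner ℂ (Jp p ξ) (μ x ξ)).re)
    {u f : LpΩ 2 Ω} (huf : (u, f) ∈ formOperator Ω μ V) (hε : 0 < ε) (hε1 : ε ≤ 1) :
    0 ≤ (c * ∫ x in Ω, starRingEnd ℂ (regPower p ε (u x)) * f x).re := by
  obtain ⟨w, hwV, rfl, hw⟩ := huf
  have hΦ := operatesOnSobolev_regPower p hε hε1
  have htest := hw _ (hΦ.superpose_mem_formDomain hΩ hV hwV)
  have hinner : ∫ x in Ω, starRingEnd ℂ (regPower p ε (w.1 x)) * f x =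
      inner ℂ (hΦ.superpose w).1 f := by
    rw [L2.inner_def]
    refine integral_congr_ae ?_
    filter_upwards [hΦ.coeFn_superpose_fst w] with x hx
    rw [hx, RCLike.inner_apply']
  rw [hinner, ← htest, form]
  refine re_mul_integral_nonneg ?_
  filter_upwards [hΦ.coeFn_superpose_snd w, hμ] with x hx hμx
  rw [hx]
  exact re_mul_inner_mapCoord_fderiv_regPower_nonneg hp hμx hε hε1 _ _

end FormTest

/-! ### The duality map of `L^p` -/

section DualPairing

variable {α : Type*} [MeasurableSpace α] {ν : Measure α} {p : ℝ≥0∞}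

theorem one_lt_toReal (hp : 1 < p) (hp' : p ≠ ⊤) : 1 < p.toReal := by
  simpa using (ENNReal.toReal_lt_toReal ENNReal.one_ne_top hp').2 hp

theorem continuous_conj_powerMap_mul {r : ℝ} (hr : 1 < r) :
    Continuous fun z : ℂ × ℂ => starRingEnd ℂ (powerMap r z.1) * z.2 :=
  (Complex.continuous_conj.comp ((continuous_powerMap hr).comp continuous_fst)).mul continuous_snd

theorem norm_conj_powerMap_mul_le {r : ℝ} (hr : 1 < r) (z : ℂ × ℂ) :
    ‖starRingEnd ℂ (powerMap r z.1) * z.2‖ ≤ 1 * ‖z‖ ^ (r / ENNReal.toReal 1) := by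
  have hr' : 0 < r - 1 := sub_pos.2 hr
  rw [norm_mul, RCLike.norm_conj, norm_powerMap hr, one_mul, ENNReal.toReal_one, div_one]
  calc ‖z.1‖ ^ (r - 1) * ‖z.2‖ ≤ ‖z‖ ^ (r - 1) * ‖z‖ ^ (1 : ℝ) := by
        rw [Real.rpow_one]
        gcongr
        exacts [norm_fst_le z, norm_snd_le z]
    _ = ‖z‖ ^ r := by
        rw [← Real.rpow_add_of_nonneg (norm_nonneg z) hr'.le zero_le_one, sub_add_cancel]

/-- The pairing `∫ f |u|^(p - 2) ū` of `f ∈ L^p` with the normalized duality functional of a unit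
vector `u ∈ L^p`. -/
noncomputable def dualPair (u f : Lp ℂ p ν) : ℂ :=
  ∫ x, starRingEnd ℂ (powerMap p.toReal (u x)) * f x ∂ν

theorem dualPair_smul_right (u f : Lp ℂ p ν) (c : ℂ) : dualPair u (c • f) = c * dualPair u f := by
  rw [dualPair, dualPair, ← integral_const_mul]
  refine integral_congr_ae ?_
  filter_upwards [Lp.coeFn_smul c f] with x hx
  rw [hx, Pi.smul_apply, smul_eq_mul, mul_left_comm]

variable [Fact (1 ≤ p)]

theorem conj_powerMap_mul_ae_eq_nemytskii (hp : 1 < p) (hp' : p ≠ ⊤) (w : Lp ℂ p ν × Lp ℂ p ν) :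
    nemytskii (q := 1) (continuous_conj_powerMap_mul (one_lt_toReal hp hp')) hp' ENNReal.one_ne_top
      (norm_conj_powerMap_mul_le (one_lt_toReal hp hp')) (pairLp p ν w) =ᵐ[ν]
      fun x => starRingEnd ℂ (powerMap p.toReal (w.1 x)) * w.2 x := by
  filter_upwards [coeFn_nemytskii (q := 1) (continuous_conj_powerMap_mul (one_lt_toReal hp hp')) hp'
    ENNReal.one_ne_top (norm_conj_powerMap_mul_le (one_lt_toReal hp hp')) (pairLp p ν w),
    coeFn_pairLp w] with x hx hw
  rw [hx, hw]

theorem integrable_conj_powerMap_mul (hp : 1 < p) (hp' : p ≠ ⊤) (u f : Lp ℂ p ν) :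
    Integrable (fun x => starRingEnd ℂ (powerMap p.toReal (u x)) * f x) ν :=
  (integrable_congr (conj_powerMap_mul_ae_eq_nemytskii hp hp' (u, f))).1 (L1.integrable_coeFn _)

theorem continuous_dualPair (hp : 1 < p) (hp' : p ≠ ⊤) :
    Continuous fun w : Lp ℂ p ν × Lp ℂ p ν => dualPair w.1 w.2 :=
  (continuous_integral.comp <| (continuous_nemytskii (q := 1)
    (continuous_conj_powerMap_mul (one_lt_toReal hp hp')) hp' ENNReal.one_ne_top
    (norm_conj_powerMap_mul_le (one_lt_toReal hp hp'))).comp (pairLp p ν).continuous).congr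
      fun w => integral_congr_ae (conj_powerMap_mul_ae_eq_nemytskii hp hp' w)

theorem dualPair_add_right (hp : 1 < p) (hp' : p ≠ ⊤) (u f g : Lp ℂ p ν) :
    dualPair u (f + g) = dualPair u f + dualPair u g := by
  rw [dualPair, dualPair, dualPair, ← integral_add (integrable_conj_powerMap_mul hp hp' u f)
    (integrable_conj_powerMap_mul hp hp' u g)]
  refine integral_congr_ae ?_
  filter_upwards [Lp.coeFn_add f g] with x hx
  rw [hx, Pi.add_apply, mul_add]

theorem norm_rpow_eq_integral (hp' : p ≠ ⊤) (u : Lp ℂ p ν) :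
    ‖u‖ ^ p.toReal = ∫ x, ‖u x‖ ^ p.toReal ∂ν := by
  rw [integral_norm_rpow_eq_toReal_eLpNorm_rpow (zero_lt_one.trans_le Fact.out).ne' hp'
    (Lp.aestronglyMeasurable u), Lp.norm_def]

theorem dualPair_self (hp : 1 < p) (hp' : p ≠ ⊤) (u : Lp ℂ p ν) :
    dualPair u u = ((‖u‖ ^ p.toReal : ℝ) : ℂ) := by
  simp only [dualPair, conj_powerMap_mul_self (one_lt_toReal hp hp'), norm_rpow_eq_integral hp',
    integral_complex_ofReal]

theorem re_dualPair_le_add (hp : 1 < p) (hp' : p ≠ ⊤) (u f : Lp ℂ p ν) :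
    (dualPair u f).re ≤
      ‖u‖ ^ p.toReal / p.toReal.conjExponent + ‖f‖ ^ p.toReal / p.toReal := by
  have hr := one_lt_toReal hp hp'
  have hconj := (Real.HolderConjugate.conjExponent hr).symm
  have hint : ∀ g : Lp ℂ p ν, Integrable (fun x => ‖g x‖ ^ p.toReal) ν := fun g =>
    (Lp.memLp g).integrable_norm_rpow (zero_lt_one.trans hp).ne' hp'
  rw [norm_rpow_eq_integral hp', norm_rpow_eq_integral hp', ← integral_div, ← integral_div,
    ← integral_add ((hint u).div_const _) ((hint f).div_const _), dualPair,
    ← RCLike.re_eq_complex_re, ← integral_re (integrable_conj_powerMap_mul hp hp' u f)]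
  refine integral_mono (integrable_conj_powerMap_mul hp hp' u f).re
    (((hint u).div_const _).add ((hint f).div_const _)) fun x => ?_
  calc RCLike.re (starRingEnd ℂ (powerMap p.toReal (u x)) * f x)
      ≤ ‖u x‖ ^ (p.toReal - 1) * ‖f x‖ := by
        refine (RCLike.re_le_norm _).trans_eq ?_
        rw [norm_mul, RCLike.norm_conj, norm_powerMap hr]
    _ ≤ (‖u x‖ ^ (p.toReal - 1)) ^ p.toReal.conjExponent / p.toReal.conjExponent +
          ‖f x‖ ^ p.toReal / p.toReal :=
        Real.young_inequality_of_nonneg (by positivity) (norm_nonneg _) hconj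
    _ = ‖u x‖ ^ p.toReal / p.toReal.conjExponent + ‖f x‖ ^ p.toReal / p.toReal := by
        rw [← Real.rpow_mul (norm_nonneg _), hconj.symm.sub_one_mul_conj]

theorem norm_add_smul_rpow_le (hp : 1 < p) (hp' : p ≠ ⊤) {u : Lp ℂ p ν} (hu : ‖u‖ = 1)
    (h : Lp ℂ p ν) (t : ℝ) :
    ‖u + (t : ℂ) • h‖ ^ p.toReal ≤
      1 + p.toReal * (t * (dualPair (u + (t : ℂ) • h) h).re) := by
  have hr := one_lt_toReal hp hp'
  set w := u + (t : ℂ) • h with hw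
  have hsplit : ‖w‖ ^ p.toReal = (dualPair w u).re + t * (dualPair w h).re := by
    rw [← Complex.re_ofReal_mul, ← Complex.add_re, ← dualPair_smul_right,
      ← dualPair_add_right hp hp', ← hw, dualPair_self hp hp', Complex.ofReal_re]
  have hyoung := re_dualPair_le_add hp hp' w u
  rw [hu, Real.one_rpow, Real.conjExponent] at hyoung
  field_simp at hyoung
  nlinarith

theorem one_add_mul_re_apply_le_norm {X : Type*} [NormedAddCommGroup X] [NormedSpace ℂ X] {u : X}
    (hu : ‖u‖ = 1) {φ : StrongDual ℂ X} (hφ : φ ∈ dualityMap u) (h : X) (t : ℝ) :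
    1 + t * (φ h).re ≤ ‖u + (t : ℂ) • h‖ := by
  have := (Complex.re_le_norm _).trans (φ.le_opNorm (u + (t : ℂ) • h))
  rwa [hφ.2, one_mul, map_add, map_smul, hφ.1, hu, smul_eq_mul, Complex.add_re,
    Complex.re_ofReal_mul, Complex.ofReal_re] at this

theorem tendsto_re_dualPair_add_smul (hp : 1 < p) (hp' : p ≠ ⊤) (u h : Lp ℂ p ν) :
    Tendsto (fun t : ℝ => (dualPair (u + (t : ℂ) • h) h).re) (𝓝[>] 0) (𝓝 (dualPair u h).re) := by
  have hline : Continuous fun t : ℝ => (u + (t : ℂ) • h, h) := by fun_prop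
  have := (Complex.continuous_re.comp ((continuous_dualPair hp hp').comp hline)).tendsto 0
  simp only [Function.comp_apply, Complex.ofReal_zero, zero_smul, add_zero] at this
  exact this.mono_left nhdsWithin_le_nhds

theorem re_apply_le_re_dualPair (hp : 1 < p) (hp' : p ≠ ⊤) {u : Lp ℂ p ν} (hu : ‖u‖ = 1)
    {φ : StrongDual ℂ (Lp ℂ p ν)} (hφ : φ ∈ dualityMap u) (h : Lp ℂ p ν) :
    (φ h).re ≤ (dualPair u h).re := by
  have hr := one_lt_toReal hp hp'
  have hr0 : 0 < p.toReal := zero_lt_one.trans hr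
  have hsmall : ∀ᶠ t : ℝ in 𝓝[>] 0, -1 < t * (φ h).re :=
    (((continuous_mul_const _).tendsto' 0 0 (zero_mul _)).eventually
      (lt_mem_nhds neg_one_lt_zero)).filter_mono nhdsWithin_le_nhds
  refine ge_of_tendsto (tendsto_re_dualPair_add_smul hp hp' u h) ?_
  filter_upwards [hsmall, self_mem_nhdsWithin] with t ht ht0
  have hbernoulli := calc 1 + p.toReal * (t * (φ h).re)
    _ ≤ (1 + t * (φ h).re) ^ p.toReal := one_add_mul_self_le_rpow_one_add ht.le hr.le
    _ ≤ ‖u + (t : ℂ) • h‖ ^ p.toReal :=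
        Real.rpow_le_rpow (by linarith) (one_add_mul_re_apply_le_norm hu hφ h t) hr0.le
    _ ≤ 1 + p.toReal * (t * (dualPair (u + (t : ℂ) • h) h).re) :=
        norm_add_smul_rpow_le hp hp' hu h t
  exact le_of_mul_le_mul_left
    (le_of_mul_le_mul_left (le_of_add_le_add_left hbernoulli) hr0) ht0

theorem apply_eq_dualPair (hp : 1 < p) (hp' : p ≠ ⊤) {u : Lp ℂ p ν} (hu : ‖u‖ = 1)
    {φ : StrongDual ℂ (Lp ℂ p ν)} (hφ : φ ∈ dualityMap u) (h : Lp ℂ p ν) :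
    φ h = dualPair u h := by
  have hre : ∀ g, (φ g).re = (dualPair u g).re := fun g => by
    refine (re_apply_le_re_dualPair hp hp' hu hφ g).antisymm ?_
    have := re_apply_le_re_dualPair hp hp' hu hφ ((-1 : ℂ) • g)
    rw [map_smul, dualPair_smul_right, smul_eq_mul] at this
    simpa using this
  refine Complex.ext (hre h) ?_
  have := hre (Complex.I • h)
  rw [map_smul, dualPair_smul_right, smul_eq_mul] at this
  simpa using this

end DualPairing

/-! ### Strongly continuous semigroups -/

section Semigroup

variable {X Y : Type*} [NormedAddCommGroup X] [NormedSpace ℂ X]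
  [NormedAddCommGroup Y] [NormedSpace ℂ Y] {T : ℝ≥0 → X →L[ℂ] X} {S : ℝ≥0 → Y →L[ℂ] Y}

theorem smul_mem_negGenerator {w : X × X} (hw : w ∈ negGenerator T) (c : ℂ) :
    c • w ∈ negGenerator T := by
  refine (hw.const_smul c).congr fun t => ?_
  rw [Prod.smul_fst, map_smul, ← smul_sub, smul_comm]

theorem IsC0Semigroup.continuous_toNNReal (hT : IsC0Semigroup T) (f : X) :
    Continuous fun s : ℝ => T s.toNNReal f :=
  (hT.continuous f).comp continuous_real_toNNReal

/-- The mean value `h⁻¹ ∫₀ʰ T(s) f ds` of an orbit of `T`. -/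
noncomputable def orbitAverage (T : ℝ≥0 → X →L[ℂ] X) (h : ℝ≥0) (f : X) : X :=
  ⨍ s in (0 : ℝ)..h, T s.toNNReal f

theorem orbitAverage_eq (T : ℝ≥0 → X →L[ℂ] X) (h : ℝ≥0) (f : X) :
    orbitAverage T h f =
      ((h : ℝ) : ℂ)⁻¹ • ∫ s in (0 : ℝ)..h, T s.toNNReal f := by
  rw [orbitAverage, interval_average_eq, sub_zero, ← Complex.ofReal_inv, Complex.coe_smul]

theorem prod_orbitAverage_mem [CompleteSpace X] [CompleteSpace Y] (hT : IsC0Semigroup T)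
    (hS : IsC0Semigroup S) {K : Submodule ℂ (X × Y)} (hK : IsClosed (K : Set (X × Y))) {f : X}
    {g : Y} (hfg : ∀ t, (T t f, S t g) ∈ K) {h : ℝ≥0} (hh : 0 < h) :
    (orbitAverage T h f, orbitAverage S h g) ∈ K := by
  have hf := (hT.continuous_toNNReal f).integrableOn_uIoc (μ := volume) (a := (0 : ℝ)) (b := h)
  have hg := (hS.continuous_toNNReal g).integrableOn_uIoc (μ := volume) (a := (0 : ℝ)) (b := h)
  rw [orbitAverage, orbitAverage, ← average_pair hf hg]
  refine (K.restrictScalars ℝ).convex.set_average_mem hK ?_ ?_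
    (ae_of_all _ fun s => hfg s.toNNReal) (hf.prodMk hg)
  · simpa [Real.volume_uIoc] using hh.ne'
  · simp

variable [CompleteSpace X]

theorem IsC0Semigroup.exists_norm_le (hT : IsC0Semigroup T) (h : ℝ≥0) :
    ∃ C, ∀ s ≤ h, ‖T s‖ ≤ C := by
  obtain ⟨C, hC⟩ := banach_steinhaus (g := fun s : Set.Iic h => T s) fun x => by
    obtain ⟨C, hC⟩ := (isCompact_Icc (a := 0) (b := h)).exists_bound_of_continuousOn
      (hT.continuous x).continuousOn
    exact ⟨C, fun s => hC s ⟨zero_le, s.2⟩⟩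
  exact ⟨C, fun s hs => hC ⟨s, hs⟩⟩

theorem continuous_orbitAverage (hT : IsC0Semigroup T) (h : ℝ≥0) :
    Continuous (orbitAverage T h) := by
  obtain ⟨C, hC⟩ := hT.exists_norm_le h
  refine (continuous_iff_continuousAt.2 fun f => ?_ : Continuous fun f : X =>
    ((h : ℝ) : ℂ)⁻¹ • ∫ s in (0 : ℝ)..h, T s.toNNReal f).congr fun f => (orbitAverage_eq T h f).symm
  refine ContinuousAt.const_smul ?_ _
  refine intervalIntegral.continuousAt_of_dominated_interval (bound := fun _ => C * (‖f‖ + 1)) ?_ ?_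
    intervalIntegrable_const ?_
  · exact Eventually.of_forall fun g => (hT.continuous_toNNReal g).aestronglyMeasurable
  · have hball : ∀ᶠ g in 𝓝 f, ‖g‖ < ‖f‖ + 1 :=
      continuous_norm.continuousAt.eventually (gt_mem_nhds (lt_add_one _))
    filter_upwards [hball] with g hg
    refine ae_of_all _ fun s hs => ?_
    rw [Set.uIoc_of_le h.coe_nonneg] at hs
    have hC' := hC s.toNNReal (Real.toNNReal_le_iff_le_coe.2 hs.2)
    exact (T s.toNNReal).le_of_opNorm_le_of_le hC' hg.le
  · exact ae_of_all _ fun s _ => (T s.toNNReal).continuous.continuousAt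

theorem IsC0Semigroup.tendsto_inv_smul_integral (hT : IsC0Semigroup T) (f : X) (a : ℝ≥0) :
    Tendsto (fun t : ℝ≥0 => ((t : ℝ) : ℂ)⁻¹ • ∫ s in (a : ℝ)..(a + t), T s.toNNReal f) (𝓝[>] 0)
      (𝓝 (T a f)) := by
  have hderiv := ((hT.continuous_toNNReal f).integral_hasStrictDerivAt a a).hasDerivAt
  have hcoe : Tendsto (fun t : ℝ≥0 => (t : ℝ)) (𝓝[>] 0) (𝓝[≠] 0) :=
    tendsto_nhdsWithin_iff.2 ⟨(NNReal.continuous_coe.tendsto 0).mono_left nhdsWithin_le_nhds,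
      eventually_nhdsWithin_of_forall fun t ht => (NNReal.coe_pos.2 ht).ne'⟩
  simpa [Function.comp_def, ← Complex.ofReal_inv] using
    (hasDerivAt_iff_tendsto_slope_zero.1 hderiv).comp hcoe

theorem tendsto_orbitAverage (hT : IsC0Semigroup T) (f : X) :
    Tendsto (fun h => orbitAverage T h f) (𝓝[>] 0) (𝓝 f) := by
  simpa only [orbitAverage_eq, NNReal.coe_zero, zero_add, hT.map_zero,
    ContinuousLinearMap.id_apply] using hT.tendsto_inv_smul_integral f 0

theorem IsC0Semigroup.map_integral (hT : IsC0Semigroup T) (h t : ℝ≥0) (f : X) :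
    T t (∫ s in (0 : ℝ)..h, T s.toNNReal f) = ∫ s in (t : ℝ)..(h + t), T s.toNNReal f := by
  have hshift := intervalIntegral.integral_comp_add_right (fun s : ℝ => T s.toNNReal f) (t : ℝ)
    (a := 0) (b := h)
  rw [zero_add] at hshift
  rw [← ContinuousLinearMap.intervalIntegral_comp_comm _
    ((hT.continuous_toNNReal f).intervalIntegrable _ _), ← hshift]
  refine intervalIntegral.integral_congr fun s hs => ?_
  rw [Set.uIcc_of_le h.coe_nonneg] at hs
  rw [Real.toNNReal_add hs.1 t.coe_nonneg, Real.toNNReal_coe, add_comm, hT.map_add]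
  rfl

theorem integral_mem_negGenerator (hT : IsC0Semigroup T) (h : ℝ≥0) (f : X) :
    (∫ s in (0 : ℝ)..h, T s.toNNReal f, f - T h f) ∈ negGenerator T := by
  have hint : ∀ a b : ℝ, IntervalIntegrable (fun s : ℝ => T s.toNNReal f) volume a b :=
    (hT.continuous_toNNReal f).intervalIntegrable
  have hlim := (hT.tendsto_inv_smul_integral f 0).sub (hT.tendsto_inv_smul_integral f h)
  rw [hT.map_zero, ContinuousLinearMap.id_apply] at hlim
  refine hlim.congr fun t => ?_
  rw [← smul_sub, hT.map_integral, NNReal.coe_zero, zero_add,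
    intervalIntegral.integral_interval_sub_interval_comm (hint _ _) (hint _ _) (hint _ _)]

theorem orbitAverage_mem_negGenerator (hT : IsC0Semigroup T) (h : ℝ≥0) (f : X) :
    (orbitAverage T h f, ((h : ℝ) : ℂ)⁻¹ • (f - T h f)) ∈ negGenerator T := by
  rw [orbitAverage_eq]
  exact smul_mem_negGenerator (integral_mem_negGenerator hT h f) _

theorem negGenerator_subset_of_isClosed (hT : IsC0Semigroup T) {E : Set X} (hE : Dense E)
    {C : Set (X × X)} (hC : IsClosed C)
    (hEC : ∀ g ∈ E, ∀ h : ℝ≥0, 0 < h → (orbitAverage T h g, ((h : ℝ) : ℂ)⁻¹ • (g - T h g)) ∈ C) :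
    negGenerator T ⊆ C := by
  have hall : ∀ h : ℝ≥0, 0 < h → ∀ g, (orbitAverage T h g, ((h : ℝ) : ℂ)⁻¹ • (g - T h g)) ∈ C := by
    intro h hh g
    have hcont : Continuous fun g => (orbitAverage T h g, ((h : ℝ) : ℂ)⁻¹ • (g - T h g)) :=
      (continuous_orbitAverage hT h).prodMk
        ((continuous_id.sub (T h).continuous).const_smul _)
    exact (hC.preimage hcont).closure_subset_iff.2 (fun g hg => hEC g hg h hh) (hE g)
  rintro ⟨u, f⟩ huf
  refine hC.mem_of_tendsto ((tendsto_orbitAverage hT u).prodMk_nhds huf) ?_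
  filter_upwards [self_mem_nhdsWithin] with h hh using hall h hh u

end Semigroup

section Consistency

variable {α : Type*} [MeasurableSpace α] {ν : Measure α} {p q : ℝ≥0∞}

/-- The space `L^p ∩ L^q`, realized as the diagonal of `L^p × L^q`. -/
def aeEqSubmodule (ν : Measure α) (p q : ℝ≥0∞) : Submodule ℂ (Lp ℂ p ν × Lp ℂ q ν) where
  carrier := {w | (w.1 : α →ₘ[ν] ℂ) = w.2}
  zero_mem' := rfl
  add_mem' hv hw := congr_arg₂ (· + ·) hv hw
  smul_mem' c _ hw := congr_arg (c • ·) hw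

theorem mem_aeEqSubmodule {w : Lp ℂ p ν × Lp ℂ q ν} : w ∈ aeEqSubmodule ν p q ↔ w.1 =ᵐ[ν] w.2 :=
  AEEqFun.ext_iff

variable [Fact (1 ≤ p)] [Fact (1 ≤ q)]

theorem isClosed_aeEqSubmodule : IsClosed (aeEqSubmodule ν p q : Set (Lp ℂ p ν × Lp ℂ q ν)) := by
  refine IsSeqClosed.isClosed fun w v hw hv => mem_aeEqSubmodule.2 ?_
  have hfst := tendstoInMeasure_of_tendsto_Lp ((continuous_fst.tendsto v).comp hv)
  have hsnd := tendstoInMeasure_of_tendsto_Lp ((continuous_snd.tendsto v).comp hv)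
  exact tendstoInMeasure_ae_unique hfst
    (hsnd.congr_left fun n => (mem_aeEqSubmodule.1 (hw n)).symm)

theorem dense_setOf_ae_eq (hp : p ≠ ⊤) (hq : q ≠ ⊤) :
    Dense {g : Lp ℂ q ν | ∃ f : Lp ℂ p ν, f =ᵐ[ν] g} := by
  refine (Lp.simpleFunc.dense (E := ℂ) (μ := ν) hq).mono fun g hg => ?_
  set s : SimpleFunc α ℂ := Lp.simpleFunc.toSimpleFunc ⟨g, hg⟩
  have hsq : MemLp s q ν := Lp.simpleFunc.memLp ⟨g, hg⟩
  have hp0 : p ≠ 0 := (zero_lt_one.trans_le Fact.out).ne'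
  have hq0 : q ≠ 0 := (zero_lt_one.trans_le Fact.out).ne'
  have hsp : MemLp s p ν := (SimpleFunc.memLp_iff hp0 hp).2 ((SimpleFunc.memLp_iff hq0 hq).1 hsq)
  exact ⟨hsp.toLp s, hsp.coeFn_toLp.trans (Lp.simpleFunc.toSimpleFunc_eq_toFun ⟨g, hg⟩)⟩

end Consistency

/-! ### The realization in `L^p` -/

section Realization

variable {d : ℕ} {Ω D : Set (Rd d)} {V : Set (LpΩ 2 Ω × L2Field Ω)} {μ : Rd d → Cd d →L[ℂ] Cd d}
  {p : ℝ≥0∞} [Fact (1 ≤ p)] {c : ℂ}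

theorem tendsto_integral_conj_regPower_mul (hp : 1 < p) (hp' : p ≠ ⊤) {u f : LpΩ 2 Ω}
    {u' f' : LpΩ p Ω} (hu : u =ᵐ[volume.restrict Ω] u') (hf : f =ᵐ[volume.restrict Ω] f') :
    Tendsto (fun ε => ∫ x in Ω, starRingEnd ℂ (regPower p.toReal ε (u x)) * f x) (𝓝[>] 0)
      (𝓝 (dualPair u' f')) := by
  have hbound : Integrable (fun x => ‖u x‖ * ‖f x‖ +
      ‖starRingEnd ℂ (powerMap p.toReal (u' x)) * f' x‖) (volume.restrict Ω) :=
    ((Lp.memLp u).norm.integrable_mul (Lp.memLp f).norm).add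
      (integrable_conj_powerMap_mul hp hp' u' f').norm
  refine tendsto_integral_filter_of_dominated_convergence _ ?_ ?_ hbound ?_
  · filter_upwards [self_mem_nhdsWithin] with ε hε
    exact ((Complex.continuous_conj.comp
      (contDiff_regPower p.toReal hε).continuous).comp_aestronglyMeasurable
        (Lp.aestronglyMeasurable u)).mul (Lp.aestronglyMeasurable f)
  · filter_upwards [Ioc_mem_nhdsGT zero_lt_one] with ε hε
    filter_upwards [hu, hf] with x hux hfx
    rw [norm_mul, norm_mul, RCLike.norm_conj, RCLike.norm_conj, ← hux, ← hfx, ← add_mul]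
    gcongr
    exact norm_regPower_le p.toReal hε.1 hε.2 _
  · filter_upwards [hu, hf] with x hux hfx
    rw [← hux, ← hfx]
    exact ((Complex.continuous_conj.tendsto _).comp ((tendsto_regPower p.toReal (u x)).mono_left
      nhdsWithin_le_nhds)).mul_const (f x)

theorem re_mul_dualPair_nonneg (hΩ : IsOpen Ω) (hV : IsFormDomain Ω D V) (hp : 1 < p)
    (hp' : p ≠ ⊤)
    (hμ : ∀ᵐ x ∂(volume.restrict Ω), ∀ ξ, 0 ≤ (c * inner ℂ (Jp p.toReal ξ) (μ x ξ)).re)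
    {u f : LpΩ 2 Ω} (huf : (u, f) ∈ formOperator Ω μ V) {u' f' : LpΩ p Ω}
    (hu : u =ᵐ[volume.restrict Ω] u') (hf : f =ᵐ[volume.restrict Ω] f') :
    0 ≤ (c * dualPair u' f').re := by
  refine ge_of_tendsto ((Complex.continuous_re.tendsto _).comp
    ((tendsto_integral_conj_regPower_mul hp hp' hu hf).const_mul c)) ?_
  filter_upwards [Ioc_mem_nhdsGT zero_lt_one] with ε hε
  exact re_mul_integral_conj_regPower_mul_nonneg hΩ hV
    (zero_lt_one.trans (one_lt_toReal hp hp')) hμ huf hε.1 hε.2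

theorem re_mul_dualPair_nonneg_of_isLpRealization (hΩ : IsOpen Ω) (hV : IsFormDomain Ω D V)
    (hp : 1 < p) (hp' : p ≠ ⊤)
    (hμ : ∀ᵐ x ∂(volume.restrict Ω), ∀ ξ, 0 ≤ (c * inner ℂ (Jp p.toReal ξ) (μ x ξ)).re)
    {Ap : Set (LpΩ p Ω × LpΩ p Ω)} (hAp : IsLpRealization (formOperator Ω μ V) Ap)
    {u f : LpΩ p Ω} (huf : (u, f) ∈ Ap) : 0 ≤ (c * dualPair u f).re := by
  obtain ⟨T, S, hT, hA, hS, hTS, rfl⟩ := hAp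
  have hclosed : IsClosed {w : LpΩ p Ω × LpΩ p Ω | 0 ≤ (c * dualPair w.1 w.2).re} :=
    isClosed_le continuous_const
      (Complex.continuous_re.comp (continuous_const.mul (continuous_dualPair hp hp')))
  suffices hsub : negGenerator S ⊆ {w | 0 ≤ (c * dualPair w.1 w.2).re} by
    simpa only [Set.mem_ofPred_eq] using hsub huf
  refine negGenerator_subset_of_isClosed hS
    (dense_setOf_ae_eq (p := 2) ENNReal.ofNat_ne_top hp') hclosed ?_
  rintro g ⟨g₂, hg⟩ h hh
  let K := aeEqSubmodule (volume.restrict Ω) 2 p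
  have hTSg : ∀ t, (T t g₂, S t g) ∈ K := fun t => mem_aeEqSubmodule.2 (hTS t g₂ g hg)
  have haverage : (orbitAverage T h g₂, orbitAverage S h g) ∈ K :=
    prod_orbitAverage_mem hT hS isClosed_aeEqSubmodule hTSg hh
  have hquotient : (((h : ℝ) : ℂ)⁻¹ • (g₂ - T h g₂), ((h : ℝ) : ℂ)⁻¹ • (g - S h g)) ∈ K :=
    K.smul_mem _ (K.sub_mem (x := (g₂, g)) (mem_aeEqSubmodule.2 hg) (hTSg h))
  have hA₂ : (orbitAverage T h g₂, ((h : ℝ) : ℂ)⁻¹ • (g₂ - T h g₂)) ∈ formOperator Ω μ V :=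
    hA.subset (orbitAverage_mem_negGenerator hT h g₂)
  exact re_mul_dualPair_nonneg hΩ hV hp hp' hμ hA₂ (mem_aeEqSubmodule.1 haverage)
    (mem_aeEqSubmodule.1 hquotient)

theorem theorem3p22_general {θ : ℝ} (hΩ : IsOpen Ω) (hV : IsFormDomain Ω D V)
    (_hμ_meas : AEStronglyMeasurable μ (volume.restrict Ω))
    (_hμ_bdd : ∃ M : ℝ, ∀ᵐ x ∂(volume.restrict Ω), ‖μ x‖ ≤ M) (hp : 1 < p) (hp' : p < ⊤)
    (hθ : 0 ≤ θ) (hθ' : θ ≤ Real.pi / 2)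
    (hN : ∀ᵐ x ∂(volume.restrict Ω), pNumericalRange p.toReal (μ x) ⊆ sector θ)
    {Ap : Set (LpΩ p Ω × LpΩ p Ω)} (hAp : IsLpRealization (formOperator Ω μ V) Ap) :
    numericalRange Ap ⊆ sector θ := by
  rintro z ⟨u, f, huf, hu, φ, hφ, rfl⟩
  refine (mem_sector_iff_forall_mem_sector hθ hθ').2 fun c hc => ?_
  rw [apply_eq_dualPair hp hp'.ne hu hφ]
  have hμ : ∀ᵐ x ∂(volume.restrict Ω), ∀ ξ, 0 ≤ (c * inner ℂ (Jp p.toReal ξ) (μ x ξ)).re :=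
    hN.mono fun x hx => re_mul_inner_Jp_nonneg hθ hθ' hx hc
  exact re_mul_dualPair_nonneg_of_isLpRealization hΩ hV hp hp'.ne hμ hAp huf

end Realization

end EllipticLp

open EllipticLp in
theorem theorem3p22 {d : ℕ} (Ω D : Set (Rd d)) (hΩ : IsOpen Ω)
    (hD : IsClosed D) (hDΩ : D ⊆ frontier Ω)
    (V : Set (LpΩ 2 Ω × L2Field Ω)) (hV : IsFormDomain Ω D V)
    (μ : Rd d → Cd d →L[ℂ] Cd d)
    (hμ_meas : AEStronglyMeasurable μ (volume.restrict Ω))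
    (hμ_bdd : ∃ M : ℝ, ∀ᵐ x ∂(volume.restrict Ω), ‖μ x‖ ≤ M)
    (hμ_ell : ∃ m : ℝ, 0 < m ∧ ∀ᵐ x ∂(volume.restrict Ω), ∀ ξ : Cd d,
      m * ‖ξ‖ ^ 2 ≤ (inner ℂ ξ (μ x ξ)).re)
    (p : ℝ≥0∞) [Fact (1 ≤ p)] (hp_one : 1 < p) (hp_top : p < ⊤)
    (θ : ℝ) (hθ_nonneg : 0 ≤ θ) (hθ_le : θ ≤ Real.pi / 2)
    (hN : ∀ᵐ x ∂(volume.restrict Ω), pNumericalRange p.toReal (μ x) ⊆ sector θ)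
    (Ap : Set (LpΩ p Ω × LpΩ p Ω)) (hAp : IsLpRealization (formOperator Ω μ V) Ap) :
    numericalRange Ap ⊆ sector θ :=
  theorem3p22_general hΩ hV hμ_meas hμ_bdd hp_one hp_top hθ_nonneg hθ_le hN hAp
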